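/- **Language.** Types are $A ::= \mathbf N \mid T$ and $T ::= \mathbf\Omega \mid A\to T$. There are countably infinitely many variables $x^A$ of each type $A$. Terms (type $\mathbf N$) are $t ::= x^{\mathbf N}\mid \mathbf Z\mid \mathbf S t$; formulas (types $T$) are $$\varphi ::= s=t \mid \varphi\lor\psi\mid\varphi\land\psi\mid x^T\mid\lambda x^A.\varphi\mid\varphi\,\psi\mid\varphi\,t\mid\mu x^T.\varphi\mid\nu x^T.\varphi ,$$ simply typed as usual ($s=t$, $\varphi\lor\psi$, $\varphi\land\psi$ have type $\mathbf\Omega$, and $\mu x^T.\varphi$, $\nu x^T.\varphi$ have type $T$ if $\varphi$ has type $T$), and taken up to renaming of bound variables. A sequent $\Gamma\vdash\Delta$ is a pair of finite sequences of formulas of type $\mathbf\Omega$. Let $\sigma$ range over $\mu,\nu$, and let $N := \mu X.\lambda x.\,(x=\mathbf Z)\lor\exists x'.(x=\mathbf S x'\land X\,x')$ where $\exists x'.\varphi := (\mu Y.\lambda x'.\,\varphi\lor Y(\mathbf S x'))\,\mathbf Z$. **Base rules** (premises $\Rightarrow$ conclusion; all sequents well-typed; substitution is capture-avoiding; $\vec\psi$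 is a sequence of formulas or terms): - (Axiom) $\Rightarrow\varphi\vdash\varphi$; (Cut) $\Gamma\vdash\varphi,\Delta$ and $\Gamma,\varphi\vdash\Delta\Rightarrow\Gamma\vdash\Delta$; weakening, contraction and exchange on both sides; (Subst) $\Gamma\vdash\Delta\Rightarrow\Gamma[u/x]\vdash\Delta[u/x]$ for $u$ of the type of $x$; - (Mono) $k$ copies of $\Gamma,\psi\,\vec y\vdash\chi\,\vec y,\Delta\Rightarrow\Gamma,\varphi[\psi/x^T]\vdash\varphi[\chi/x^T],\Delta$, where $k$ is the number of free occurrences of $x$ in $\varphi$, $\psi$ and $\chi$ have type $T$, and the distinct variables $\vec y$ are not free in $\Gamma,\psi,\chi,\Delta$; - logical rules: $(=\!L)$ $\Gamma[t/x,s/y]\vdash\Delta[t/x,s/y]\Rightarrow\Gamma[s/x,t/y],s=t\vdash\Delta[s/x,t/y]$ (for distinct $x,y$ of type $\mathbf N$); $(=\!R)$ $\Rightarrow\Gamma\vdash t=t,\Delta$; $(\lor L)$ $\Gamma,\varphi\vdash\Delta$ and $\Gamma,\psi\vdash\Delta\Rightarrow\Gamma,\varphi\lor\psi\vdash\Delta$;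 $(\lor R)$ $\Gamma\vdash\varphi,\psi,\Delta\Rightarrow\Gamma\vdash\varphi\lor\psi,\Delta$; $(\land L)$ $\Gamma,\varphi,\psi\vdash\Delta\Rightarrow\Gamma,\varphi\land\psi\vdash\Delta$; $(\land R)$ $\Gamma\vdash\varphi,\Delta$ and $\Gamma\vdash\psi,\Delta\Rightarrow\Gamma\vdash\varphi\land\psi,\Delta$; $(\lambda L),(\lambda R)$, with premise formula $\varphi[\psi/x]\,\vec\psi$ and conclusion formula $(\lambda x.\varphi)\,\psi\,\vec\psi$ on the left or right; $(\sigma L),(\sigma R)$, with premise formula $\varphi[\sigma x.\varphi/x]\,\vec\psi$ and conclusion formula $(\sigma x.\varphi)\,\vec\psi$ on the left or right; - (Nat) $\Gamma,N\,x^{\mathbf N}\vdash\Delta\Rightarrow\Gamma\vdash\Delta$; (P1) $\Rightarrow\mathbf S s=\mathbf Z\vdash$; (P2) $\Gamma,s=t\vdash\Delta\Rightarrow\Gamma,\mathbf S s=\mathbf S t\vdash\Delta$. **Park's rules**, for distinct variables $\vec y$ not free in $\Gamma,\varphi[\chi/x],\chi,\Delta$: - (Pre) $\Gamma,\varphi[\chi/x]\,\vec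 y\vdash\chi\,\vec y,\Delta$ and $\Gamma,\chi\,\vec\psi\vdash\Delta\Rightarrow\Gamma,(\mu x.\varphi)\,\vec\psi\vdash\Delta$; - (Post) $\Gamma,\chi\,\vec y\vdash\varphi[\chi/x]\,\vec y,\Delta$ and $\Gamma\vdash\chi\,\vec\psi,\Delta\Rightarrow\Gamma\vdash(\nu x.\varphi)\,\vec\psi,\Delta$. **Cyclic proofs.** A pre-proof is a finite derivation tree, some of whose leaves may be open (not derived by a rule), with a function sending each open leaf to a non-leaf node with the same sequent. A path passes from an open leaf to its assigned node and from any other node to one of its premises. A formula occurrence in a premise is relevant to one in the conclusion, on the same side, if both are corresponding formulas of the contexts $\Gamma,\Delta$ (in (Subst) and $(=\!L)$: before and after substitution), or if they correspond in an exchange, or if the former is one of the displayed non-context formulas of the premise and the latter the principal (non-context) formula of contraction, (Mono), $(\lor)$, $(\land)$, $(\lambda)$, $(\sigma)$ or (P2); nothing is relevant to the principal formula of (Pre) or (Post). From an open leaf to its assigned node occurrences are kept. A trace in an infinite path is a choice of an occurrence $\tau_i$ in the $i$-th sequent such that $\tau_{i+1}$ is always relevant to $\tau_i$ and $\tau_i$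 is infinitely often the principal occurrence of a logical rule. Along a trace, label the fixed-point operators in $\tau_i$ by finite sequences of natural numbers: all labels in $\tau_0$ are empty; if $\tau_i=(\sigma_p x.\varphi)\,\vec\psi$ is principal for $(\sigma L)$ or $(\sigma R)$ then $\tau_{i+1}=\varphi[\sigma_{p.k}x.\varphi/x]\,\vec\psi$ with $k$ not used before; if $\tau_i$, with labels, is $\varphi[\psi_1/x,\dots,\psi_k/x]$ (where $\psi_j$ is put for the $j$-th occurrence of $x$) and is principal for (Mono), then in the $j$-th premise $\tau_{i+1}=\psi_j\,\vec y$; otherwise labels are inherited from the corresponding operators. The trace is a $\mu$-trace (resp. $\nu$-trace) if for some infinite sequence $p$ every finite initial segment of $p$ is the label of some $\mu$ (resp. $\nu$) in some $\tau_i$. A cyclic proof is a pre-proof in which every infinite path has a tail with a $\mu$-trace on the left side of the sequents or a $\nu$-trace on the right side. **Proposition.** If a sequent $\Gamma\vdash\Delta$ has a cyclic proof using the base rules together with (Pre) and (Post), then it has a cyclic proof using only the base rules. -/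

import Mathlib

namespace HFL

/-! ### Types, variables, expressions -/

mutual
/-- Argument types `A ::= N | T`. -/
inductive Ty where
  | nat : Ty
  | pred : PTy → Ty
  deriving DecidableEq
/-- Predicate types `T ::= Ω | A → T`. -/
inductive PTy where
  | omega : PTy
  | arr : Ty → PTy → PTy
  deriving DecidableEq
end

/-- Variables. Each variable `x^A` carries its type, and there are countably infinitely many
variables of every type. -/
structure Var where
  name : ℕ
  ty : Ty
  deriving DecidableEq

/-- The two fixed-point operators. -/
inductive FixOp where
  | mu : FixOp
  | nu : FixOp
  deriving DecidableEq

/-- Terms and formulas, up to renaming of bound variables: free variables are named (`fvar`),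
bound variables are de Bruijn indices (`bvar`). Terms are the expressions of type `N`, formulas
those of a predicate type. Every fixed-point operator carries a label in `L`. -/
inductive Expr (L : Type) where
  | bvar : ℕ → Expr L
  | fvar : Var → Expr L
  | zero : Expr L
  | succ : Expr L → Expr L
  | eq : Expr L → Expr L → Expr L
  | or : Expr L → Expr L → Expr L
  | and : Expr L → Expr L → Expr L
  | lam : Ty → Expr L → Expr L
  | app : Expr L → Expr L → Expr L
  | fix : FixOp → L → PTy → Expr L → Expr L

/-- Ordinary expressions (no information in the labels). -/
abbrev Fm := Expr Unit

/-- Annotated expressions: fixed-point operators carry a finite sequence of natural numbers. -/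
abbrev AFm := Expr (List ℕ)

namespace Expr

variable {L M : Type}

/-- Apply `f` to all labels. -/
def map (f : L → M) : Expr L → Expr M
  | bvar i => bvar i
  | fvar x => fvar x
  | zero => zero
  | succ t => succ (t.map f)
  | eq s t => eq (s.map f) (t.map f)
  | or a b => or (a.map f) (b.map f)
  | and a b => and (a.map f) (b.map f)
  | lam A a => lam A (a.map f)
  | app a b => app (a.map f) (b.map f)
  | fix σ l T a => fix σ (f l) T (a.map f)

/-- Replace the bound variable with index `d` by the expression `u`, which is meant to have no
dangling bound variables (so that nothing has to be shifted and nothing can be captured). -/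
def instAt (u : Expr L) : ℕ → Expr L → Expr L
  | d, bvar i => if i = d then u else bvar i
  | _, fvar x => fvar x
  | _, zero => zero
  | d, succ t => succ (instAt u d t)
  | d, eq s t => eq (instAt u d s) (instAt u d t)
  | d, or a b => or (instAt u d a) (instAt u d b)
  | d, and a b => and (instAt u d a) (instAt u d b)
  | d, lam A a => lam A (instAt u (d + 1) a)
  | d, app a b => app (instAt u d a) (instAt u d b)
  | d, fix σ l T a => fix σ l T (instAt u (d + 1) a)

/-- `φ[u/x]` where `φ` is the body of a binder `λx`, `μx`, `νx` (or an expression with a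
distinguished variable `x`), `x` being represented by the bound variable `0`. -/
def inst (φ u : Expr L) : Expr L := instAt u 0 φ

/-- Simultaneous substitution for free variables (the expressions `θ x` are meant to have no
dangling bound variables). -/
def subst (θ : Var → Expr L) : Expr L → Expr L
  | bvar i => bvar i
  | fvar x => θ x
  | zero => zero
  | succ t => succ (t.subst θ)
  | eq s t => eq (s.subst θ) (t.subst θ)
  | or a b => or (a.subst θ) (b.subst θ)
  | and a b => and (a.subst θ) (b.subst θ)
  | lam A a => lam A (a.subst θ)
  | app a b => app (a.subst θ) (b.subst θ)
  | fix σ l T a => fix σ l T (a.subst θ)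

/-- Free variables. -/
def fv : Expr L → Finset Var
  | bvar _ => ∅
  | fvar x => {x}
  | zero => ∅
  | succ t => t.fv
  | eq s t => s.fv ∪ t.fv
  | or a b => a.fv ∪ b.fv
  | and a b => a.fv ∪ b.fv
  | lam _ a => a.fv
  | app a b => a.fv ∪ b.fv
  | fix _ _ _ a => a.fv

/-- `φ e₁ … eₙ`. -/
def apps (φ : Expr L) (es : List (Expr L)) : Expr L := es.foldl app φ

/-- `φ y₁ … yₙ` for variables `yᵢ`. -/
def appVars (φ : Expr L) (ys : List Var) : Expr L := φ.apps (ys.map fvar)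

/-- The number of occurrences of the bound variable `d`. -/
def countAt : ℕ → Expr L → ℕ
  | d, bvar i => if i = d then 1 else 0
  | _, fvar _ => 0
  | _, zero => 0
  | d, succ t => countAt d t
  | d, eq s t => countAt d s + countAt d t
  | d, or a b => countAt d a + countAt d b
  | d, and a b => countAt d a + countAt d b
  | d, lam _ a => countAt (d + 1) a
  | d, app a b => countAt d a + countAt d b
  | d, fix _ _ _ a => countAt (d + 1) a

/-- The fixed-point operator `σ` with label `l` occurs in the expression. -/
def HasFix (σ : FixOp) (l : L) : Expr L → Prop
  | bvar _ => False
  | fvar _ => False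
  | zero => False
  | succ t => t.HasFix σ l
  | eq s t => s.HasFix σ l ∨ t.HasFix σ l
  | or a b => a.HasFix σ l ∨ b.HasFix σ l
  | and a b => a.HasFix σ l ∨ b.HasFix σ l
  | lam _ a => a.HasFix σ l
  | app a b => a.HasFix σ l ∨ b.HasFix σ l
  | fix σ' l' _ a => (σ' = σ ∧ l' = l) ∨ a.HasFix σ l

end Expr

/-- Typing. The list gives the types of the bound variables; the types of the free variables are
those they carry. -/
inductive HasType : List Ty → Fm → Ty → Prop where
  | bvar {B : List Ty} {i : ℕ} {A : Ty} : B[i]? = some A → HasType B (.bvar i) A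
  | fvar {B : List Ty} {x : Var} : HasType B (.fvar x) x.ty
  | zero {B : List Ty} : HasType B .zero .nat
  | succ {B : List Ty} {t : Fm} : HasType B t .nat → HasType B (.succ t) .nat
  | eq {B : List Ty} {s t : Fm} :
      HasType B s .nat → HasType B t .nat → HasType B (.eq s t) (.pred .omega)
  | or {B : List Ty} {φ ψ : Fm} : HasType B φ (.pred .omega) → HasType B ψ (.pred .omega) →
      HasType B (.or φ ψ) (.pred .omega)
  | and {B : List Ty} {φ ψ : Fm} : HasType B φ (.pred .omega) → HasType B ψ (.pred .omega) →
      HasType B (.and φ ψ) (.pred .omega)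
  | lam {B : List Ty} {A : Ty} {T : PTy} {φ : Fm} : HasType (A :: B) φ (.pred T) →
      HasType B (.lam A φ) (.pred (.arr A T))
  | app {B : List Ty} {A : Ty} {T : PTy} {φ e : Fm} : HasType B φ (.pred (.arr A T)) →
      HasType B e A → HasType B (.app φ e) (.pred T)
  | fix {B : List Ty} {σ : FixOp} {T : PTy} {φ : Fm} : HasType (.pred T :: B) φ (.pred T) →
      HasType B (.fix σ () T φ) (.pred T)

/-- `N ≡ μX. λx. x = Z ∨ ∃x'. (x = S x' ∧ X x')`, where
`∃x'. φ` is `(μY. λx'. φ ∨ Y (S x')) Z`. -/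
def natPred : Fm :=
  .fix .mu () (.arr .nat .omega) (.lam .nat (.or
    (.eq (.bvar 0) .zero)
    (.app
      (.fix .mu () (.arr .nat .omega) (.lam .nat (.or
        (.and (.eq (.bvar 2) (.succ (.bvar 0))) (.app (.bvar 3) (.bvar 0)))
        (.app (.bvar 1) (.succ (.bvar 0))))))
      .zero)))

/-! ### Sequents and rules -/

inductive Side where
  | left : Side
  | right : Side
  deriving DecidableEq

/-- A sequent `Γ ⊢ Δ`. Both sequences are listed starting at the turnstile: `suc` is `Δ` from left
to right, `ant` is `Γ` from right to left. So `Γ, φ ⊢ Δ` has `ant = φ :: Γ` and `Γ ⊢ φ, Δ` has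
`suc = φ :: Δ`. -/
@[ext]
structure Sequent where
  ant : List Fm
  suc : List Fm

namespace Sequent

/-- The formulas on a given side. -/
def side (S : Sequent) : Side → List Fm
  | .left => S.ant
  | .right => S.suc

/-- Put the formulas of `P` next to the turnstile of `C`, i.e. form `Γ, P.ant ⊢ P.suc, Δ` from
`C = (Γ ⊢ Δ)`. -/
def add (P C : Sequent) : Sequent := ⟨P.ant ++ C.ant, P.suc ++ C.suc⟩

/-- The sequent with the formulas `l` on side `s` and none on the other side. -/
def on : Side → List Fm → Sequent
  | .left, l => ⟨l, []⟩
  | .right, l => ⟨[], l⟩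

/-- `Γ[θ] ⊢ Δ[θ]`. -/
def subst (θ : Var → Fm) (C : Sequent) : Sequent :=
  ⟨C.ant.map (Expr.subst θ), C.suc.map (Expr.subst θ)⟩

/-- The variable `y` is not free in the sequent. -/
def Fresh (y : Var) (C : Sequent) : Prop := (∀ φ ∈ C.ant, y ∉ φ.fv) ∧ ∀ φ ∈ C.suc, y ∉ φ.fv

/-- All formulas of the sequent have type `Ω`. -/
def WellTyped (C : Sequent) : Prop :=
  (∀ φ ∈ C.ant, HasType [] φ (.pred .omega)) ∧ ∀ φ ∈ C.suc, HasType [] φ (.pred .omega)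

end Sequent

/-- The substitution `[u/x]`. -/
def single (x : Var) (u : Fm) : Var → Fm := Function.update Expr.fvar x u

/-- The simultaneous substitution `[u/x, v/y]` (for `x ≠ y`). -/
def double (x : Var) (u : Fm) (y : Var) (v : Fm) : Var → Fm :=
  Function.update (Function.update Expr.fvar x u) y v

/-- Instances of the deduction rules, given by their data. `C` is the context `Γ ⊢ Δ`. A rule that
exists in a left and a right version has a `Side` argument. In `mono`, `lam`, `fix`, `pre` and
`post`, the variable `x` of `φ` is the bound variable `0`. -/
inductive Rule where
  | ax (φ : Fm)
  | cut (C : Sequent) (φ : Fm)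
  | wk (s : Side) (C : Sequent) (φ : Fm)
  | ctr (s : Side) (C : Sequent) (φ : Fm)
  | ex (s : Side) (Θ : List Fm) (φ ψ : Fm) (C : Sequent)
  | subst (C : Sequent) (x : Var) (u : Fm)
  | mono (C : Sequent) (T : PTy) (φ ψ χ : Fm) (ys : List Var)
  | eqL (C : Sequent) (x y : Var) (s t : Fm)
  | eqR (C : Sequent) (t : Fm)
  | orL (C : Sequent) (φ ψ : Fm)
  | orR (C : Sequent) (φ ψ : Fm)
  | andL (C : Sequent) (φ ψ : Fm)
  | andR (C : Sequent) (φ ψ : Fm)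
  | lam (s : Side) (C : Sequent) (A : Ty) (φ ψ : Fm) (ψs : List Fm)
  | fix (s : Side) (C : Sequent) (σ : FixOp) (T : PTy) (φ : Fm) (ψs : List Fm)
  | nat (C : Sequent) (x : Var)
  | p1 (s : Fm)
  | p2 (C : Sequent) (s t : Fm)
  | pre (C : Sequent) (T : PTy) (φ χ : Fm) (ψs : List Fm) (ys : List Var)
  | post (C : Sequent) (T : PTy) (φ χ : Fm) (ψs : List Fm) (ys : List Var)

namespace Rule

/-- The context `Γ ⊢ Δ` as it stands in the conclusion. -/
def conclCtx : Rule → Sequent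
  | ax _ | p1 _ => ⟨[], []⟩
  | cut C _ | wk _ C _ | ctr _ C _ | ex _ _ _ _ C | mono C _ _ _ _ _ | eqR C _
  | orL C _ _ | orR C _ _ | andL C _ _ | andR C _ _ | lam _ C _ _ _ _ | fix _ C _ _ _ _
  | nat C _ | p2 C _ _ | pre C _ _ _ _ _ | post C _ _ _ _ _ => C
  | subst C x u => C.subst (single x u)
  | eqL C x y s t => C.subst (double x s y t)

/-- The context as it stands in the premises. -/
def premCtx : Rule → Sequent
  | subst C _ _ => C
  | eqL C x y s t => C.subst (double x t y s)
  | r => r.conclCtx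

/-- The formulas of the conclusion that do not belong to the context: the principal formulas. -/
def conclAct : Rule → Sequent
  | ax φ => ⟨[φ], [φ]⟩
  | cut _ _ => ⟨[], []⟩
  | wk s _ φ => .on s [φ]
  | ctr s _ φ => .on s [φ]
  | ex s Θ φ ψ _ => .on s (Θ ++ [φ, ψ])
  | subst _ _ _ => ⟨[], []⟩
  | mono _ _ φ ψ χ _ => ⟨[φ.inst ψ], [φ.inst χ]⟩
  | eqL _ _ _ s t => ⟨[.eq s t], []⟩
  | eqR _ t => ⟨[], [.eq t t]⟩
  | orL _ φ ψ => ⟨[.or φ ψ], []⟩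
  | orR _ φ ψ => ⟨[], [.or φ ψ]⟩
  | andL _ φ ψ => ⟨[.and φ ψ], []⟩
  | andR _ φ ψ => ⟨[], [.and φ ψ]⟩
  | lam s _ A φ ψ ψs => .on s [((Expr.lam A φ).app ψ).apps ψs]
  | fix s _ σ T φ ψs => .on s [(Expr.fix σ () T φ).apps ψs]
  | nat _ _ => ⟨[], []⟩
  | p1 s => ⟨[.eq (.succ s) .zero], []⟩
  | p2 _ s t => ⟨[.eq (.succ s) (.succ t)], []⟩
  | pre _ T φ _ ψs _ => ⟨[(Expr.fix .mu () T φ).apps ψs], []⟩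
  | post _ T φ _ ψs _ => ⟨[], [(Expr.fix .nu () T φ).apps ψs]⟩

/-- For each premise, the formulas that do not belong to the context. `mono` has one copy of its
premise for every occurrence of `x` in `φ`. -/
def premAct : Rule → List Sequent
  | ax _ => []
  | cut _ φ => [⟨[], [φ]⟩, ⟨[φ], []⟩]
  | wk _ _ _ => [⟨[], []⟩]
  | ctr s _ φ => [.on s [φ, φ]]
  | ex s Θ φ ψ _ => [.on s (Θ ++ [ψ, φ])]
  | subst _ _ _ => [⟨[], []⟩]
  | mono _ _ φ ψ χ ys => List.replicate (φ.countAt 0) ⟨[ψ.appVars ys], [χ.appVars ys]⟩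
  | eqL _ _ _ _ _ => [⟨[], []⟩]
  | eqR _ _ => []
  | orL _ φ ψ => [⟨[φ], []⟩, ⟨[ψ], []⟩]
  | orR _ φ ψ => [⟨[], [φ, ψ]⟩]
  | andL _ φ ψ => [⟨[ψ, φ], []⟩]
  | andR _ φ ψ => [⟨[], [φ]⟩, ⟨[], [ψ]⟩]
  | lam s _ _ φ ψ ψs => [.on s [(φ.inst ψ).apps ψs]]
  | fix s _ σ T φ ψs => [.on s [(φ.inst (.fix σ () T φ)).apps ψs]]
  | nat _ x => [⟨[.app natPred (.fvar x)], []⟩]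
  | p1 _ => []
  | p2 _ s t => [⟨[.eq s t], []⟩]
  | pre _ _ φ χ ψs ys =>
      [⟨[(φ.inst χ).appVars ys], [χ.appVars ys]⟩, ⟨[χ.apps ψs], []⟩]
  | post _ _ φ χ ψs ys =>
      [⟨[χ.appVars ys], [(φ.inst χ).appVars ys]⟩, ⟨[], [χ.apps ψs]⟩]

/-- The conclusion. -/
def concl (r : Rule) : Sequent := r.conclAct.add r.conclCtx

/-- The premises, from left to right. -/
def prems (r : Rule) : List Sequent := r.premAct.map fun P => P.add r.premCtx

/-- Side conditions: the typing of the data, and the freshness conditions. -/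
def SideCond : Rule → Prop
  | subst _ x u => HasType [] u x.ty
  | mono C T φ ψ χ ys =>
      HasType [.pred T] φ (.pred .omega) ∧ HasType [] ψ (.pred T) ∧ HasType [] χ (.pred T) ∧
      ys.Nodup ∧ ∀ y ∈ ys, C.Fresh y ∧ y ∉ ψ.fv ∧ y ∉ χ.fv
  | eqL _ x y _ _ => x ≠ y ∧ x.ty = .nat ∧ y.ty = .nat
  | pre C T φ χ _ ys | post C T φ χ _ ys =>
      HasType [.pred T] φ (.pred T) ∧ HasType [] χ (.pred T) ∧
      ys.Nodup ∧ ∀ y ∈ ys, C.Fresh y ∧ y ∉ (φ.inst χ).fv ∧ y ∉ χ.fv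
  | _ => True

/-- Correct rule instances: all sequents are well-typed and the side conditions hold. -/
def Correct (r : Rule) : Prop :=
  r.concl.WellTyped ∧ (∀ S ∈ r.prems, S.WellTyped) ∧ r.SideCond

/-- The rules (Pre) and (Post). -/
def IsPark : Rule → Prop
  | pre _ _ _ _ _ _ | post _ _ _ _ _ _ => True
  | _ => False

/-- The logical rules. -/
def IsLogical : Rule → Prop
  | eqL _ _ _ _ _ | eqR _ _ | orL _ _ _ | orR _ _ _ | andL _ _ _ | andR _ _ _
  | lam _ _ _ _ _ _ | fix _ _ _ _ _ _ => True
  | _ => False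

/-- The rules `μL`, `μR`, `νL`, `νR`. -/
def IsFix : Rule → Prop
  | fix _ _ _ _ _ _ => True
  | _ => False

end Rule

/-- The rules of the cyclic proof system. -/
def baseRules : Set Rule := {r | ¬ r.IsPark}

/-- The rules (Pre) and (Post). -/
def parkRules : Set Rule := {r | r.IsPark}

/-! ### Occurrences and annotations -/

/-- An occurrence of a formula in a sequent: a side and a position, counted from the turnstile. -/
@[ext]
structure Occ where
  side : Side
  idx : ℕ

/-- The formula of `S` at the occurrence `o`, if there is one. -/
def Sequent.at (S : Sequent) (o : Occ) : Option Fm := (S.side o.side)[o.idx]?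

namespace Rule

/-- The occurrence `o` in the conclusion does not belong to the context. -/
def Principal (r : Rule) (o : Occ) : Prop := o.idx < (r.conclAct.side o.side).length

instance (r : Rule) (o : Occ) : Decidable (r.Principal o) :=
  inferInstanceAs (Decidable (_ < _))

/-- Relevance between non-context occurrences of the conclusion (position `i`) and non-context
occurrences of a premise (position `i'`), on the same side `s`. Nothing in a premise is relevant to
the principal formula of (Pre) or (Post). -/
def RelAct : Rule → Side → ℕ → ℕ → Prop
  | ex _ Θ _ _ _, _, i, i' => i' = Equiv.swap Θ.length (Θ.length + 1) i
  | ctr _ _ _, _, _, _ | mono _ _ _ _ _ _, _, _, _ | orL _ _ _, _, _, _ | orR _ _ _, _, _, _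
  | andL _ _ _, _, _, _ | andR _ _ _, _, _, _ | lam _ _ _ _ _ _, _, _, _
  | fix _ _ _ _ _ _, _, _, _ | p2 _ _ _, _, _, _ => True
  | _, _, _, _ => False

/-- `o'` in the `j`-th premise of `r` (counted from `0`) is a relevant occurrence of `o` in the
conclusion: both are corresponding context formulas, or both are outside the context and related
by `RelAct`. -/
def Relevant (r : Rule) (j : ℕ) (o o' : Occ) : Prop :=
  o'.side = o.side ∧ ∃ P, r.premAct[j]? = some P ∧
    ((∃ i, o.idx = (r.conclAct.side o.side).length + i ∧ o'.idx = (P.side o.side).length + i) ∨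
      (r.Principal o ∧ o'.idx < (P.side o.side).length ∧ r.RelAct o.side o.idx o'.idx))

end Rule

namespace Expr

/-- Annotate the formula `φ` with the labels that `a` has at the same positions; used when `a`
is an annotated formula from which `φ` arises by replacing some subexpressions by variables, or by
changing some terms. (Terms contain no fixed-point operators.) -/
def relabel : Fm → AFm → AFm
  | or φ ψ, or a b => or (relabel φ a) (relabel ψ b)
  | and φ ψ, and a b => and (relabel φ a) (relabel ψ b)
  | lam A φ, lam _ a => lam A (relabel φ a)
  | app φ ψ, app a b => app (relabel φ a) (relabel ψ b)
  | fix σ _ T φ, fix _ l _ a => fix σ l T (relabel φ a)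
  | φ, _ => φ.map fun _ => []

/-- The subexpressions of `a` at the positions, from left to right, where `φ` has the bound
variable `d`; used when `a` is an annotated version of the result of replacing this variable
in `φ`. -/
def holes : ℕ → Fm → AFm → List AFm
  | d, bvar i, a => if i = d then [a] else []
  | d, succ s, succ a => holes d s a
  | d, eq s t, eq a b => holes d s a ++ holes d t b
  | d, or φ ψ, or a b => holes d φ a ++ holes d ψ b
  | d, and φ ψ, and a b => holes d φ a ++ holes d ψ b
  | d, lam _ φ, lam _ a => holes (d + 1) φ a
  | d, app φ ψ, app a b => holes d φ a ++ holes d ψ b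
  | d, fix _ _ _ φ, fix _ _ _ a => holes (d + 1) φ a
  | _, _, _ => []

/-- `(λx. a) b c₁ … cₙ ↦ a[b/x] c₁ … cₙ`. -/
def betaHead : AFm → AFm
  | app (lam _ a) b => a.inst b
  | app a b => app (betaHead a) b
  | a => a

/-- `(σ_p x. a) c₁ … cₙ ↦ a[σ_{p.k} x. a / x] c₁ … cₙ`. -/
def unfoldHead (k : ℕ) : AFm → AFm
  | fix σ p T a => a.inst (fix σ (p ++ [k]) T a)
  | app a b => app (unfoldHead k a) b
  | a => a

/-- The two immediate subformulas of a disjunction or conjunction. -/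
def component (second : Prop) [Decidable second] : AFm → AFm
  | or a b => if second then b else a
  | and a b => if second then b else a
  | a => a

end Expr

/-- If `a` is the annotated formula at the occurrence `o` in the conclusion of `r`, and `φ'` is the
formula at the relevant occurrence `o'` in the `j`-th premise, this is `φ'` with its annotation.
The number `k` is used to extend the label of an unfolded fixed-point operator. -/
def Rule.annotate (r : Rule) (j : ℕ) (o o' : Occ) (k : ℕ) (φ' : Fm) (a : AFm) :
    AFm :=
  if r.Principal o then
    match r with
    | .orL _ _ _ => a.component (j = 1)
    | .orR _ _ _ => a.component (o'.idx = 1)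
    -- the premise is `Γ, φ, ψ ⊢ Δ`, so the position next to the turnstile is `ψ`
    | .andL _ _ _ => a.component (o'.idx = 0)
    | .andR _ _ _ => a.component (j = 1)
    | .lam _ _ _ _ _ _ => a.betaHead
    | .fix _ _ _ _ _ _ => a.unfoldHead k
    | .mono _ _ φ _ _ ys => ((φ.holes 0 a).getD j a).appVars ys
    | _ => Expr.relabel φ' a
  else Expr.relabel φ' a

/-! ### Pre-proofs and cyclic proofs -/

/-- Pre-proofs with rules from `R`: a finite derivation tree together with a function `back` that
assigns to each open leaf a non-leaf node with the same sequent. -/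
structure PreProof (R : Set Rule) where
  Node : Type
  finite_node : Finite Node
  root : Node
  /-- The `j`-th child of a node. -/
  child : Node → ℕ → Option Node
  /-- The root is not a child, -/
  child_ne_root : ∀ n j, child n j ≠ some root
  /-- every node is a child in at most one way, -/
  child_inj : ∀ n n' j j' m, child n j = some m → child n' j' = some m → n = n' ∧ j = j'
  /-- and every node is a descendant of the root. -/
  reachable : ∀ m, Relation.ReflTransGen (fun a b => ∃ j, child a j = some b) root m
  sequent : Node → Sequent
  /-- The rule instance by which the sequent of a node is derived; `none` at open leaves. -/
  rule : Node → Option Rule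
  rule_mem : ∀ n r, rule n = some r → r ∈ R
  rule_correct : ∀ n r, rule n = some r → r.Correct
  rule_concl : ∀ n r, rule n = some r → r.concl = sequent n
  rule_prems : ∀ n r, rule n = some r → ∀ j, (child n j).map sequent = r.prems[j]?
  open_leaf : ∀ n, rule n = none → ∀ j, child n j = none
  /-- Only the values at open leaves matter. -/
  back : Node → Node
  back_sequent : ∀ n, rule n = none → sequent (back n) = sequent n
  back_nonleaf : ∀ n, rule n = none → ∃ j m, child (back n) j = some m

namespace PreProof

variable {R : Set Rule} (P : PreProof R)

/-- The possible steps of a path: from an open leaf `n` to `back n`, from another node to a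
premise. -/
def Edge (n m : P.Node) : Prop :=
  (P.rule n = none ∧ m = P.back n) ∨ ∃ j, P.child n j = some m

/-- Infinite paths. -/
def IsPath (π : ℕ → P.Node) : Prop := ∀ i, P.Edge (π i) (π (i + 1))

/-- `o'` at the node `m` is a relevant occurrence of `o` at the node `n`. -/
def Relevant (n m : P.Node) (o o' : Occ) : Prop :=
  (P.rule n = none ∧ m = P.back n ∧ o' = o) ∨
    ∃ r j, P.rule n = some r ∧ P.child n j = some m ∧ r.Relevant j o o'

/-- `o` is the principal occurrence of a logical rule at the node `n`. -/
def LogicalAt (n : P.Node) (o : Occ) : Prop :=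
  ∃ r, P.rule n = some r ∧ r.IsLogical ∧ r.Principal o

/-- `o` is the principal occurrence of a rule `σL` or `σR` at the node `n`. -/
def FixAt (n : P.Node) (o : Occ) : Prop :=
  ∃ r, P.rule n = some r ∧ r.IsFix ∧ r.Principal o

/-- Pre-traces in an infinite path. -/
def IsPreTrace (π : ℕ → P.Node) (τ : ℕ → Occ) : Prop :=
  (∀ i, ((P.sequent (π i)).at (τ i)).isSome) ∧
    ∀ i, P.Relevant (π i) (π (i + 1)) (τ i) (τ (i + 1))

/-- Traces in an infinite path. -/
def IsTrace (π : ℕ → P.Node) (τ : ℕ → Occ) : Prop :=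
  P.IsPreTrace π τ ∧ ∀ N, ∃ i, N ≤ i ∧ P.LogicalAt (π i) (τ i)

/-- `a'` is the annotated formula at `o'` in `m`, given that `a` is the one at `o` in `n`. -/
def AnnStep (n m : P.Node) (o o' : Occ) (k : ℕ) (a a' : AFm) : Prop :=
  (P.rule n = none ∧ a' = a) ∨
    ∃ r j φ', P.rule n = some r ∧ P.child n j = some m ∧ (P.sequent m).at o' = some φ' ∧
      a' = r.annotate j o o' k φ' a

/-- `a i` is the annotated formula at `τ i`, where the number `k i` is used if the step `i` unfolds
a fixed-point operator; these numbers are different for different unfoldings. -/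
structure IsAnnotation (π : ℕ → P.Node) (τ : ℕ → Occ) (k : ℕ → ℕ) (a : ℕ → AFm) : Prop where
  init : ∃ φ, (P.sequent (π 0)).at (τ 0) = some φ ∧ a 0 = φ.map fun _ => []
  step : ∀ i, P.AnnStep (π i) (π (i + 1)) (τ i) (τ (i + 1)) (k i) (a i) (a (i + 1))
  fresh : Set.InjOn k {i | P.FixAt (π i) (τ i)}

/-- `μ`-traces and `ν`-traces: some infinite sequence `p` has all its finite initial segments
assigned to occurrences of the operator `σ`. -/
def IsFixTrace (σ : FixOp) (π : ℕ → P.Node) (τ : ℕ → Occ) : Prop :=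
  P.IsTrace π τ ∧ ∃ k a, P.IsAnnotation π τ k a ∧
    ∃ p : ℕ → ℕ, ∀ n, ∃ i, (a i).HasFix σ ((List.range n).map p)

/-- The global trace condition: every infinite path has a tail with a left `μ`-trace or a right
`ν`-trace. -/
def GlobalTraceCondition : Prop :=
  ∀ π, P.IsPath π → ∃ N τ,
    ((τ 0).side = .left ∧ P.IsFixTrace .mu (fun i => π (N + i)) τ) ∨
    ((τ 0).side = .right ∧ P.IsFixTrace .nu (fun i => π (N + i)) τ)

end PreProof

/-- There is a cyclic proof of `S` with rules from `R`. -/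
def CyclicallyProvable (R : Set Rule) (S : Sequent) : Prop :=
  ∃ P : PreProof R, P.sequent P.root = S ∧ P.GlobalTraceCondition

end HFL

-- An application of (Pre) can be simulated by a small cycle of base rules. To obtain Γ, (μx.φ)ψ⃗ ⊢
-- Δ, cut on χψ⃗. One side of the cut is the second premise of (Pre), up to exchange and weakening.
-- The other side, Γ, (μx.φ)ψ⃗ ⊢ χψ⃗, Δ, follows by (Mono), applied to the formula x ψ⃗, from Γ,
-- (μx.φ)y⃗ ⊢ χy⃗, Δ, the companion `loop`. There the fixed point is unfolded to φ[μx.φ/x]y⃗, and a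
-- cut on φ[χ/x]y⃗ leaves the first premise of (Pre) on one side and φ[μx.φ/x]y⃗ ⊢ φ[χ/x]y⃗ in
-- context on the other. (Mono) reduces the latter to copies of the companion, one for each
-- occurrence of x, and these are open leaves pointing back to it. (Post) is the mirror image, so
-- both are treated at once with a `Side` parameter.
--
-- `PreProof.elim` performs this replacement at all applications simultaneously. For its global
-- trace condition (`GlobalTraceCondition.elim`) there are two kinds of infinite path.
--
-- If the path meets old nodes infinitely often, deleting the new nodes gives an infinite path of
-- the old proof, some tail of which has a good trace. At an application of Park's rules such a
-- trace can only follow a context formula, because nothing is relevant to the principal formula.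
-- Context formulas pass unchanged through the inserted derivation, so the trace lifts together with
-- its annotation (`IsFixTrace.elim`).
--
-- Otherwise the path finally stays inside one inserted derivation, and there it can only run around
-- the cycle. The fixed-point formula is a trace: it is unfolded at every visit to the companion,
-- and (Mono) leads from the unfolded body to a copy of the fixed point carrying the extended label.
-- The labels along this trace are the finite initial segments of one infinite sequence
-- (`isFixTrace_cycle`).

namespace HFL

-- Substitution, iterated application and labels

namespace Expr

variable {L : Type}

@[simp] lemma apps_nil (φ : Expr L) : φ.apps [] = φ := rfl

@[simp] lemma apps_cons (φ e : Expr L) (es : List (Expr L)) :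
    φ.apps (e :: es) = (φ.app e).apps es := rfl

lemma instAt_apps (u : Expr L) (d : ℕ) (φ : Expr L) (es : List (Expr L)) :
    instAt u d (φ.apps es) = (instAt u d φ).apps (es.map (instAt u d)) := by
  induction es generalizing φ with
  | nil => rfl
  | cons e es ih => simp [ih, instAt]

lemma countAt_apps (d : ℕ) (φ : Expr L) (es : List (Expr L)) :
    countAt d (φ.apps es) = countAt d φ + (es.map (countAt d)).sum := by
  induction es generalizing φ with
  | nil => rfl
  | cons e es ih => simp [ih, countAt, add_assoc]

lemma inst_appVars (φ u : Expr L) (ys : List Var) :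
    (φ.appVars ys).inst u = (φ.inst u).appVars ys := by
  simp [inst, appVars, instAt_apps, Function.comp_def, instAt]

/-- Substitution for a bound variable removes no free variable. Hence freshness for φ[χ/x], the side
condition of Park's rules, yields freshness for the fixed point, which (Mono) requires. -/
lemma fv_subset_fv_instAt (u : Expr L) (d : ℕ) (φ : Expr L) : φ.fv ⊆ (instAt u d φ).fv := by
  induction φ generalizing d with
  | bvar i => simp [fv]
  | fvar x => simp [instAt]
  | zero => simp [instAt]
  | succ t ih => exact ih d
  | eq s t ihs iht => exact Finset.union_subset_union (ihs d) (iht d)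
  | or a b iha ihb => exact Finset.union_subset_union (iha d) (ihb d)
  | and a b iha ihb => exact Finset.union_subset_union (iha d) (ihb d)
  | lam A a ih => exact ih (d + 1)
  | app a b iha ihb => exact Finset.union_subset_union (iha d) (ihb d)
  | fix σ l T a ih => exact ih (d + 1)

lemma map_instAt {M : Type} (f : L → M) (u : Expr L) (d : ℕ) (φ : Expr L) :
    (instAt u d φ).map f = instAt (u.map f) d (φ.map f) := by
  induction φ generalizing d with
  | bvar i => simp only [instAt, map]; split <;> rfl
  | _ => simp_all [instAt, map]

lemma map_apps {M : Type} (f : L → M) (φ : Expr L) (es : List (Expr L)) :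
    (φ.apps es).map f = (φ.map f).apps (es.map (Expr.map f)) := by
  induction es generalizing φ with
  | nil => rfl
  | cons e es ih => simp [ih, map]

lemma map_appVars {M : Type} (f : L → M) (φ : Expr L) (ys : List Var) :
    (φ.appVars ys).map f = (φ.map f).appVars ys := by
  simp [appVars, map_apps, Function.comp_def, map]

lemma map_map_unit (f : Unit → L) (φ : Fm) : (φ.map f).map (fun _ => ()) = φ := by
  induction φ <;> simp_all [map]

lemma hasFix_apps {σ : FixOp} {l : L} {φ : Expr L} (h : φ.HasFix σ l) (es : List (Expr L)) :
    (φ.apps es).HasFix σ l := by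
  induction es generalizing φ with
  | nil => exact h
  | cons e es ih => exact ih (Or.inl h)

/-! ### Annotations -/

lemma relabel_map (φ : Fm) : relabel φ (φ.map fun _ => []) = φ.map fun _ => [] := by
  induction φ <;> simp_all [relabel, map]

/-- A context formula is relabelled once by Park's rule but several times on its way through the
derivation replacing it; idempotence makes the two annotations agree. -/
lemma relabel_relabel (φ : Fm) (a : AFm) : relabel φ (relabel φ a) = relabel φ a := by
  induction φ generalizing a with
  | or φ ψ ihφ ihψ | and φ ψ ihφ ihψ | app φ ψ ihφ ihψ =>
    cases a <;> simp [relabel, map, ihφ, ihψ, relabel_map]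
  | lam A φ ih | fix σ l T φ ih => cases a <;> simp [relabel, map, ih, relabel_map]
  | _ => cases a <;> simp [relabel, map]

/-- The recursion of `holes` follows the pattern φ and never descends into the inserted copies, so
each hole returns exactly one copy of `u`. -/
lemma holes_instAt (u : AFm) (d : ℕ) (φ : Fm) :
    holes d φ (instAt u d (φ.map fun _ => [])) = List.replicate (countAt d φ) u := by
  induction φ generalizing d with
  | bvar i => by_cases h : i = d <;> simp [holes, map, instAt, countAt, h]
  | eq _ _ ih₁ ih₂ | or _ _ ih₁ ih₂ | and _ _ ih₁ ih₂ | app _ _ ih₁ ih₂ =>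
    simp only [map, instAt, holes, countAt, List.replicate_add]
    rw [ih₁, ih₂]
  | lam _ _ ih | fix _ _ _ _ ih => exact ih (d + 1)
  | succ _ ih => exact ih d
  | _ => simp [holes, countAt]

lemma holes_appVars (d : ℕ) (φ : Fm) (a : AFm) (ys : List Var) :
    holes d (φ.appVars ys) (a.appVars ys) = holes d φ a := by
  induction ys generalizing φ a with
  | nil => rfl
  | cons y ys ih =>
    refine (ih (φ.app (.fvar y)) (a.app (.fvar y))).trans ?_
    simp [holes]

lemma unfoldHead_appVars (k : ℕ) (σ : FixOp) (p : List ℕ) (T : PTy) (a : AFm) (ys : List Var) :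
    unfoldHead k ((fix σ p T a).appVars ys) =
      (a.inst (fix σ (p ++ [k]) T a)).appVars ys := by
  induction ys using List.reverseRecOn with
  | nil => rfl
  | append_singleton ys y ih =>
    simp only [appVars, apps, List.map_append, List.foldl_append, List.map_cons, List.map_nil,
      List.foldl_cons, List.foldl_nil] at ih ⊢
    simp only [unfoldHead, ih]

end Expr

-- Typing, substitution and replacement of heads

namespace HasType

lemma unique {B : List Ty} {e : Fm} {A A' : Ty} (h : HasType B e A) (h' : HasType B e A') :
    A = A' := by
  induction h generalizing A' with
  | bvar h => cases h' with | bvar h' => simpa [h] using h'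
  | lam _ ih => cases h' with | lam h' => simpa using ih h'
  | app _ _ ih _ => cases h' with | app h₁ _ => have := ih h₁; simp_all
  | _ => cases h'; rfl

/-- Indices count from the innermost binder, so types appended at the outer end require no shift. -/
lemma weaken {B : List Ty} {e : Fm} {A : Ty} (h : HasType B e A) (B' : List Ty) :
    HasType (B ++ B') e A := by
  induction h with
  | bvar h => exact .bvar (by rw [List.getElem?_append_left (List.getElem?_eq_some_iff.1 h).1, h])
  | fvar => exact .fvar
  | zero => exact .zero
  | succ _ ih => exact .succ ih
  | eq _ _ ih₁ ih₂ => exact .eq ih₁ ih₂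
  | or _ _ ih₁ ih₂ => exact .or ih₁ ih₂
  | and _ _ ih₁ ih₂ => exact .and ih₁ ih₂
  | lam _ ih => exact .lam ih
  | app _ _ ih₁ ih₂ => exact .app ih₁ ih₂
  | fix _ ih => exact .fix ih

lemma instAt_eq {B : List Ty} {e : Fm} {A : Ty} (h : HasType B e A) (u : Fm) {d : ℕ}
    (hd : B.length ≤ d) : Expr.instAt u d e = e := by
  induction h generalizing d with
  | bvar h =>
    have := (List.getElem?_eq_some_iff.1 h).1
    exact if_neg (by omega)
  | lam _ ih | fix _ ih => simp [Expr.instAt, ih (d := d + 1) (by simpa using hd)]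
  | _ => simp_all [Expr.instAt]

lemma countAt_eq_zero {B : List Ty} {e : Fm} {A : Ty} (h : HasType B e A) {d : ℕ}
    (hd : B.length ≤ d) : Expr.countAt d e = 0 := by
  induction h generalizing d with
  | bvar h =>
    have := (List.getElem?_eq_some_iff.1 h).1
    exact if_neg (by omega)
  | lam _ ih | fix _ ih => simp [Expr.countAt, ih (d := d + 1) (by simpa using hd)]
  | _ => simp_all [Expr.countAt]

lemma instAt {B : List Ty} {e u : Fm} {A A' : Ty} (h : HasType (B ++ [A']) e A)
    (hu : HasType [] u A') : HasType B (Expr.instAt u B.length e) A := by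
  generalize hB : B ++ [A'] = B' at h
  induction h generalizing B with
  | @bvar _ i _ h =>
    subst hB
    by_cases hi : i = B.length
    · subst hi
      obtain rfl : A' = _ := by simpa using h
      simpa [Expr.instAt] using hu.weaken B
    · have h' := (List.getElem?_eq_some_iff.1 h).1
      simp only [List.length_append, List.length_singleton] at h'
      rw [List.getElem?_append_left (by omega)] at h
      simpa [Expr.instAt, hi] using HasType.bvar h
  | fvar => exact .fvar
  | zero => exact .zero
  | succ _ ih => exact .succ (ih hB)
  | eq _ _ ih₁ ih₂ => exact .eq (ih₁ hB) (ih₂ hB)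
  | or _ _ ih₁ ih₂ => exact .or (ih₁ hB) (ih₂ hB)
  | and _ _ ih₁ ih₂ => exact .and (ih₁ hB) (ih₂ hB)
  | lam _ ih => exact .lam (ih (B := _ :: B) (by simp [hB]))
  | app _ _ ih₁ ih₂ => exact .app (ih₁ hB) (ih₂ hB)
  | fix _ ih => exact .fix (ih (B := _ :: B) (by simp [hB]))

lemma head_of_apps {B : List Ty} {f : Fm} {es : List Fm} {A : Ty} (h : HasType B (f.apps es) A) :
    ∃ A', HasType B f A' := by
  induction es generalizing f with
  | nil => exact ⟨A, h⟩
  | cons e es ih =>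
    obtain ⟨_, h'⟩ := ih h
    cases h' with | app h₁ _ => exact ⟨_, h₁⟩

lemma args_of_apps {B : List Ty} {f : Fm} {es : List Fm} {A : Ty} (h : HasType B (f.apps es) A) :
    ∀ e ∈ es, ∃ A', HasType B e A' := by
  induction es generalizing f with
  | nil => simp
  | cons e es ih =>
    obtain ⟨_, h'⟩ := head_of_apps (f := f.app e) h
    cases h' with | app _ h₂ => exact List.forall_mem_cons.2 ⟨⟨_, h₂⟩, ih h⟩

/-- The head of an application can be replaced by an expression of the same type. -/
lemma apps_congr {B : List Ty} {f g : Fm} {es : List Fm} {A A' : Ty}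
    (h : HasType [] (f.apps es) A') (hf : HasType [] f A) (hg : HasType B g A) :
    HasType B (g.apps es) A' := by
  induction es generalizing f g A with
  | nil => exact unique hf h ▸ hg
  | cons e es ih =>
    obtain ⟨_, h'⟩ := head_of_apps (f := f.app e) h
    cases h' with
    | app h₁ h₂ =>
      obtain rfl := unique hf h₁
      exact ih h (.app h₁ h₂) (.app hg (h₂.weaken B))

end HasType

/-- Expressions of type `N` contain no fixed-point operators, hence carry no labels that erasure
could lose. -/
lemma Expr.eq_map_of_hasType_nat {B : List Ty} (a : AFm) (h : HasType B (a.map fun _ => ()) .nat) :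
    (a.map fun _ => ()).map (fun _ => []) = a := by
  induction a with
  | succ t ih => cases h with | succ h => simp [map, ih h]
  | bvar | fvar | zero => rfl
  | _ => cases h

/-- Relabelling a well-typed annotated formula by its own labels changes nothing. -/
lemma Expr.relabel_self {B : List Ty} {A : Ty} (a : AFm) (h : HasType B (a.map fun _ => ()) A) :
    relabel (a.map fun _ => ()) a = a := by
  induction a generalizing B A with
  | bvar | fvar | zero => rfl
  | succ t => cases h with | succ h => exact eq_map_of_hasType_nat (B := B) _ (.succ h)
  | eq s t =>
    cases h with
    | eq h₁ h₂ => simp [map, relabel, eq_map_of_hasType_nat _ h₁, eq_map_of_hasType_nat _ h₂]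
  | or _ _ ih₁ ih₂ => cases h with | or h₁ h₂ => simp [map, relabel, ih₁ h₁, ih₂ h₂]
  | and _ _ ih₁ ih₂ => cases h with | and h₁ h₂ => simp [map, relabel, ih₁ h₁, ih₂ h₂]
  | app _ _ ih₁ ih₂ => cases h with | app h₁ h₂ => simp [map, relabel, ih₁ h₁, ih₂ h₂]
  | lam _ _ ih => cases h with | lam h => simp [map, relabel, ih h]
  | fix _ _ _ _ ih => cases h with | fix h => simp [map, relabel, ih h]

/-! ### Deriving Park's rules -/

/-- The fixed-point operator for which there is a Park rule on the given side. -/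
def Side.op : Side → FixOp
  | .left => .mu
  | .right => .nu

def Side.other : Side → Side
  | .left => .right
  | .right => .left

/-- The index of the premise of a cut that has the cut formula on the given side. -/
def Side.cutIdx : Side → ℕ
  | .left => 1
  | .right => 0

/-- The sequent with the formulas `l` on the side `s` and `l'` on the other side. -/
def Sequent.onBoth : Side → List Fm → List Fm → Sequent
  | .left, l, l' => ⟨l, l'⟩
  | .right, l, l' => ⟨l', l⟩

/-- The data of an instance of (Pre) (with `side = left`) or (Post) (with `side = right`). -/
structure Park where
  side : Side
  ctx : Sequent
  ty : PTy
  body : Fm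
  inv : Fm
  args : List Fm
  vars : List Var

/-- The data of a rule instance, if it is one of Park's rules. -/
def Rule.park? : Rule → Option Park
  | pre C T φ χ ψs ys => some ⟨.left, C, T, φ, χ, ψs, ys⟩
  | post C T φ χ ψs ys => some ⟨.right, C, T, φ, χ, ψs, ys⟩
  | _ => none

lemma Rule.park?_eq_none {r : Rule} : r.park? = none ↔ ¬ r.IsPark := by
  cases r <;> simp [park?, IsPark]

namespace Park

/-- The instance of (Pre) or (Post). -/
def rule : Park → Rule
  | ⟨.left, C, T, φ, χ, ψs, ys⟩ => .pre C T φ χ ψs ys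
  | ⟨.right, C, T, φ, χ, ψs, ys⟩ => .post C T φ χ ψs ys

end Park

lemma Rule.eq_rule_of_park? {r : Rule} {d : Park} (h : r.park? = some d) : r = d.rule := by
  cases r <;> simp only [park?, Option.some.injEq, reduceCtorEq] at h <;> subst h <;> rfl

/-- The positions in a derivation of the conclusion of one of Park's rules from its premises,
other than the conclusion and the premises. The number of leaves is `k`. -/
inductive Park.Pos (k : ℕ) where
  | spec
  | swap
  | drop
  | loop
  | unfolded
  | monoSwap
  | monoDrop
  | mono
  | leaf (j : Fin k)
  | premSwap
  | premDrop
  deriving DecidableEq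

namespace Park

open Sequent

variable (d : Park)

/-- The fixed-point formula. -/
def fixpt : Fm := .fix d.side.op () d.ty d.body

/-- The number of occurrences of the variable of the fixed-point operator in its body. -/
def occs : ℕ := (d.body.appVars d.vars).countAt 0

/-- The cut formula of the outer cut. -/
def cutArgs : Fm := d.inv.apps d.args

/-- The cut formula of the inner cut. -/
def cutVars : Fm := (d.body.inst d.inv).appVars d.vars

def fixArgs : Fm := d.fixpt.apps d.args

def fixVars : Fm := d.fixpt.appVars d.vars

def invVars : Fm := d.inv.appVars d.vars

def unfVars : Fm := (d.body.inst d.fixpt).appVars d.vars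

/-- The formulas at a position that do not belong to the context of the rule. -/
def act : Pos d.occs → Sequent
  | .spec => onBoth d.side [d.fixArgs] [d.cutArgs]
  | .swap => onBoth d.side [d.cutArgs, d.fixArgs] []
  | .drop => onBoth d.side [d.fixArgs, d.cutArgs] []
  | .loop | .leaf _ => onBoth d.side [d.fixVars] [d.invVars]
  | .unfolded => onBoth d.side [d.unfVars] [d.invVars]
  | .monoSwap => onBoth d.side [d.unfVars] [d.cutVars, d.invVars]
  | .monoDrop => onBoth d.side [d.unfVars] [d.invVars, d.cutVars]
  | .mono => onBoth d.side [d.unfVars] [d.cutVars]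
  | .premSwap => onBoth d.side [d.cutVars, d.unfVars] [d.invVars]
  | .premDrop => onBoth d.side [d.unfVars, d.cutVars] [d.invVars]

/-- The rule applied at the conclusion. -/
def entryRule : Rule := .cut d.rule.concl d.cutArgs

/-- The rule applied at a position. -/
def posRule : Pos d.occs → Option Rule
  | .spec => some <| match d.side with
    | .left => .mono d.ctx d.ty ((Expr.bvar 0).apps d.args) d.fixpt d.inv d.vars
    | .right => .mono d.ctx d.ty ((Expr.bvar 0).apps d.args) d.inv d.fixpt d.vars
  | .swap => some <| .ex d.side [] d.cutArgs d.fixArgs d.ctx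
  | .drop => some <| .wk d.side ((onBoth d.side [d.cutArgs] []).add d.ctx) d.fixArgs
  | .loop => some <| .fix d.side ((onBoth d.side [] [d.invVars]).add d.ctx) d.side.op d.ty d.body
      (d.vars.map .fvar)
  | .unfolded => some <| .cut ((onBoth d.side [d.unfVars] [d.invVars]).add d.ctx) d.cutVars
  | .monoSwap => some <|
      .ex d.side.other [] d.cutVars d.invVars ((onBoth d.side [d.unfVars] []).add d.ctx)
  | .monoDrop => some <|
      .wk d.side.other ((onBoth d.side [d.unfVars] [d.cutVars]).add d.ctx) d.invVars
  | .mono => some <| match d.side with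
    | .left => .mono d.ctx d.ty (d.body.appVars d.vars) d.fixpt d.inv d.vars
    | .right => .mono d.ctx d.ty (d.body.appVars d.vars) d.inv d.fixpt d.vars
  | .leaf _ => none
  | .premSwap => some <|
      .ex d.side [] d.cutVars d.unfVars ((onBoth d.side [] [d.invVars]).add d.ctx)
  | .premDrop => some <|
      .wk d.side ((onBoth d.side [d.cutVars] [d.invVars]).add d.ctx) d.unfVars

/-- The premises of a cut, where `a` has the cut formula on the side other than `s`. -/
def cutChild {α : Type} (s : Side) (a b : α) (j : ℕ) : Option α :=
  if j = s.other.cutIdx then some a else if j = s.cutIdx then some b else none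

/-- The premises of the conclusion. -/
def entry : ℕ → Option (Pos d.occs) := cutChild d.side .spec .swap

/-- The premises of a position; `inr j` is the `j`-th premise of Park's rule. -/
def next : Pos d.occs → ℕ → Option (Pos d.occs ⊕ ℕ)
  | .spec, 0 => some (.inl .loop)
  | .swap, 0 => some (.inl .drop)
  | .drop, 0 => some (.inr 1)
  | .loop, 0 => some (.inl .unfolded)
  | .unfolded, j => cutChild d.side (.inl .monoSwap) (.inl .premSwap) j
  | .monoSwap, 0 => some (.inl .monoDrop)
  | .monoDrop, 0 => some (.inl .mono)
  | .mono, j => if h : j < d.occs then some (.inl (.leaf ⟨j, h⟩)) else none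
  | .premSwap, 0 => some (.inl .premDrop)
  | .premDrop, 0 => some (.inr 0)
  | _, _ => none

/-- The position (`none` is the conclusion) and the index of which a position or premise is the
premise. -/
def parent : Pos d.occs ⊕ ℕ → Option (Pos d.occs) × ℕ
  | .inl .spec => (none, d.side.other.cutIdx)
  | .inl .swap => (none, d.side.cutIdx)
  | .inl .drop => (some .swap, 0)
  | .inl .loop => (some .spec, 0)
  | .inl .unfolded => (some .loop, 0)
  | .inl .monoSwap => (some .unfolded, d.side.other.cutIdx)
  | .inl .monoDrop => (some .monoSwap, 0)
  | .inl .mono => (some .monoDrop, 0)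
  | .inl (.leaf j) => (some .mono, j)
  | .inl .premSwap => (some .unfolded, d.side.cutIdx)
  | .inl .premDrop => (some .premSwap, 0)
  | .inr 0 => (some .premDrop, 0)
  | .inr _ => (some .drop, 0)

lemma cutChild_eq_some {α : Type} {s : Side} {a b x : α} {j : ℕ}
    (h : cutChild s a b j = some x) :
    x = a ∧ j = s.other.cutIdx ∨
      x = b ∧ j = s.cutIdx := by
  simp only [cutChild] at h
  split_ifs at h with hj
  · simp_all
  · simp_all

variable {d}

/-- With `parent_of_next`, this says that `parent` inverts the child relation; the inserted
derivation is therefore a tree, each position being a child in only one way. -/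
lemma parent_of_entry {j : ℕ} {i : Pos d.occs} (h : d.entry j = some i) :
    d.parent (.inl i) = (none, j) := by
  rcases cutChild_eq_some h with ⟨rfl, rfl⟩ | ⟨rfl, rfl⟩ <;> rfl

lemma parent_of_next {i : Pos d.occs} {j : ℕ} {x : Pos d.occs ⊕ ℕ} (h : d.next i j = some x) :
    d.parent x = (some i, j) := by
  cases i
  case unfolded => rcases cutChild_eq_some h with ⟨rfl, rfl⟩ | ⟨rfl, rfl⟩ <;> rfl
  case mono =>
    simp only [next, Option.dite_none_right_eq_some, Option.some.injEq] at h
    obtain ⟨_, rfl⟩ := h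
    rfl
  all_goals
    rcases j with _ | j <;> simp only [next, Option.some.injEq, reduceCtorEq] at h
    try subst h
    try rfl

/-- A premise of a rule as a whole: its active formulas. -/
def target : Pos d.occs ⊕ ℕ → Option Sequent
  | .inl i => some (d.act i)
  | .inr j => d.rule.premAct[j]?

variable (d)

lemma conclCtx_rule : d.rule.conclCtx = d.ctx := by
  obtain ⟨_ | _, _⟩ := d <;> rfl

lemma premCtx_rule : d.rule.premCtx = d.ctx := by
  obtain ⟨_ | _, _⟩ := d <;> rfl

lemma prems_rule : d.rule.prems = [(onBoth d.side [d.cutVars] [d.invVars]).add d.ctx,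
    (onBoth d.side [d.cutArgs] []).add d.ctx] := by
  obtain ⟨_ | _, _⟩ := d <;> rfl

/-! #### Typing -/

variable {d}

lemma side_conditions (h : d.rule.Correct) :
    HasType [.pred d.ty] d.body (.pred d.ty) ∧ HasType [] d.inv (.pred d.ty) ∧
      d.vars.Nodup ∧ ∀ y ∈ d.vars, d.ctx.Fresh y ∧ y ∉ (d.body.inst d.inv).fv ∧ y ∉ d.inv.fv := by
  obtain ⟨_ | _, _⟩ := d <;> exact h.2.2

lemma hasType_fixpt (h : d.rule.Correct) : HasType [] d.fixpt (.pred d.ty) :=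
  .fix (side_conditions h).1

lemma onBoth_add_wellTyped {s : Side} {l l' : List Fm} {C : Sequent} :
    ((onBoth s l l').add C).WellTyped ↔ (∀ φ ∈ l, HasType [] φ (.pred .omega)) ∧
      (∀ φ ∈ l', HasType [] φ (.pred .omega)) ∧ C.WellTyped := by
  cases s <;>
    simp only [WellTyped, Sequent.add, onBoth, List.mem_append, or_imp, forall_and] <;> tauto

lemma wellTyped_prem (h : d.rule.Correct) :
    HasType [] d.cutVars (.pred .omega) ∧ HasType [] d.invVars (.pred .omega) ∧
      HasType [] d.cutArgs (.pred .omega) ∧ d.ctx.WellTyped := by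
  have h₁ := h.2.1
  rw [prems_rule] at h₁
  simp only [List.mem_cons, List.not_mem_nil, or_false, forall_eq_or_imp, forall_eq,
    onBoth_add_wellTyped] at h₁
  tauto

/-- The formulas that do not occur in the premises of Park's rule arise from χψ⃗ or χy⃗ by putting
the fixed point or its unfolding, both of the same type, for the head χ. -/
lemma wellTyped_act (h : d.rule.Correct) (i : Pos d.occs) : ((d.act i).add d.ctx).WellTyped := by
  obtain ⟨h₁, h₂, h₃, h₄⟩ := wellTyped_prem h
  have hinv := (side_conditions h).2.1
  have h₅ : HasType [] d.fixArgs (.pred .omega) := h₃.apps_congr hinv (hasType_fixpt h)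
  have h₆ : HasType [] d.fixVars (.pred .omega) := h₂.apps_congr hinv (hasType_fixpt h)
  have h₇ : HasType [] d.unfVars (.pred .omega) :=
    h₂.apps_congr hinv (HasType.instAt (B := []) (side_conditions h).1 (hasType_fixpt h))
  cases i <;> simp [act, onBoth_add_wellTyped, *]

lemma fresh_fixpt (h : d.rule.Correct) {y : Var} (hy : y ∈ d.vars) : y ∉ d.fixpt.fv := fun hy' =>
  ((side_conditions h).2.2.2 y hy).2.1 (Expr.fv_subset_fv_instAt _ _ _ hy')

/-- The arguments are typable without bound variables, so the substitution only touches the head.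
With `countAt_apps_args`, this makes (Mono) at `spec` a one-premise rule that trades the arguments
ψ⃗ for the fresh variables y⃗. -/
lemma inst_apps_args (h : d.rule.Correct) (u : Fm) :
    ((Expr.bvar 0).apps d.args).inst u = u.apps d.args := by
  rw [Expr.inst, Expr.instAt_apps, List.map_congr_left (g := id), List.map_id]
  · rfl
  · intro e he
    obtain ⟨_, he⟩ := HasType.args_of_apps (wellTyped_prem h).2.2.1 e he
    exact he.instAt_eq u le_rfl

lemma countAt_apps_args (h : d.rule.Correct) : ((Expr.bvar 0).apps d.args).countAt 0 = 1 := by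
  rw [Expr.countAt_apps, List.sum_eq_zero]
  · rfl
  · simp only [List.mem_map]
    rintro _ ⟨e, he, rfl⟩
    obtain ⟨_, he⟩ := HasType.args_of_apps (wellTyped_prem h).2.2.1 e he
    exact he.countAt_eq_zero le_rfl

/-! #### Correctness of the rules -/

lemma concl_posRule (h : d.rule.Correct) {i : Pos d.occs} {r : Rule} (hr : d.posRule i = some r) :
    r.concl = (d.act i).add d.ctx := by
  cases i
  case spec =>
    cases hs : d.side <;> simp only [posRule, Option.some.injEq, hs] at hr <;> subst hr <;>
      simp [Rule.concl, Rule.conclAct, Rule.conclCtx, act, hs, onBoth, inst_apps_args h, fixArgs,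
        cutArgs]
  case mono =>
    cases hs : d.side <;> simp only [posRule, Option.some.injEq, hs] at hr <;> subst hr <;>
      simp [Rule.concl, Rule.conclAct, Rule.conclCtx, act, hs, onBoth, Expr.inst_appVars, unfVars,
        cutVars]
  all_goals
    simp only [posRule, Option.some.injEq, reduceCtorEq] at hr
  all_goals
    subst hr
    obtain ⟨_ | _, _⟩ := d <;> rfl

lemma prems_posRule (h : d.rule.Correct) {i : Pos d.occs} {r : Rule} (hr : d.posRule i = some r)
    (j : ℕ) : (d.next i j).bind (fun x => (target x).map fun P => P.add d.ctx) = r.prems[j]? := by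
  cases i
  case spec =>
    cases hs : d.side <;> simp only [posRule, Option.some.injEq, hs] at hr <;> subst hr <;>
      rcases j with _ | j <;>
      simp [Rule.prems, Rule.premAct, Rule.premCtx, Rule.conclCtx, target, next, act, hs, onBoth,
        countAt_apps_args h, fixVars, invVars]
  case mono =>
    cases hs : d.side <;> simp only [posRule, Option.some.injEq, hs] at hr <;> subst hr <;>
      simp only [Rule.prems, Rule.premAct, next, List.getElem?_map, List.getElem?_replicate] <;>
      by_cases hj : j < d.occs <;> have hj' := hj <;> rw [occs] at hj' <;>
      simp [hj, hj', target, act, hs, onBoth, fixVars, invVars, Rule.premCtx, Rule.conclCtx]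
  all_goals
    simp only [posRule, Option.some.injEq, reduceCtorEq] at hr
  all_goals
    subst hr
    obtain ⟨_ | _, _⟩ := d <;> rcases j with _ | _ | j <;> rfl

lemma correct_posRule (h : d.rule.Correct) {i : Pos d.occs} {r : Rule} (hr : d.posRule i = some r) :
    r.Correct := by
  refine ⟨concl_posRule h hr ▸ wellTyped_act h i, fun S hS => ?_, ?_⟩
  · obtain ⟨j, hj⟩ := List.mem_iff_getElem?.1 hS
    rw [← prems_posRule h hr] at hj
    simp only [Option.bind_eq_some_iff, Option.map_eq_some_iff] at hj
    obtain ⟨x, -, P, hP, rfl⟩ := hj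
    rcases x with i' | j'
    · obtain rfl : d.act i' = P := by simpa [target] using hP
      exact wellTyped_act h i'
    · refine h.2.1 _ (List.mem_iff_getElem?.2 ⟨j', ?_⟩)
      simp only [target] at hP
      simp [Rule.prems, hP, premCtx_rule]
  · obtain ⟨hb, hinv, hnd, hfr⟩ := side_conditions h
    cases i
    case spec =>
      have ht : HasType [.pred d.ty] ((Expr.bvar 0).apps d.args) (.pred .omega) :=
        (wellTyped_prem h).2.2.1.apps_congr hinv (.bvar rfl)
      cases hs : d.side <;> simp only [posRule, Option.some.injEq, hs] at hr <;> subst hr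
      · exact ⟨ht, hasType_fixpt h, hinv, hnd,
          fun y hy => ⟨(hfr y hy).1, fresh_fixpt h hy, (hfr y hy).2.2⟩⟩
      · exact ⟨ht, hinv, hasType_fixpt h, hnd,
          fun y hy => ⟨(hfr y hy).1, (hfr y hy).2.2, fresh_fixpt h hy⟩⟩
    case mono =>
      have ht : HasType [.pred d.ty] (d.body.appVars d.vars) (.pred .omega) :=
        (wellTyped_prem h).2.1.apps_congr hinv hb
      cases hs : d.side <;> simp only [posRule, Option.some.injEq, hs] at hr <;> subst hr
      · exact ⟨ht, hasType_fixpt h, hinv, hnd,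
          fun y hy => ⟨(hfr y hy).1, fresh_fixpt h hy, (hfr y hy).2.2⟩⟩
      · exact ⟨ht, hinv, hasType_fixpt h, hnd,
          fun y hy => ⟨(hfr y hy).1, (hfr y hy).2.2, fresh_fixpt h hy⟩⟩
    all_goals
      simp only [posRule, Option.some.injEq, reduceCtorEq] at hr
    all_goals
      subst hr
      trivial

lemma not_isPark_posRule {i : Pos d.occs} {r : Rule} (hr : d.posRule i = some r) : ¬ r.IsPark := by
  cases i <;> simp only [posRule, Option.some.injEq, reduceCtorEq] at hr <;> subst hr <;>
    first | exact id | (cases d.side <;> exact id)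

variable (d)

lemma prems_entryRule (j : ℕ) :
    (d.entry j).map (fun i => (d.act i).add d.ctx) = d.entryRule.prems[j]? := by
  obtain ⟨_ | _, _⟩ := d <;> rcases j with _ | _ | j <;> rfl

lemma correct_entryRule (h : d.rule.Correct) : d.entryRule.Correct := by
  refine ⟨h.1, fun S hS => ?_, trivial⟩
  obtain ⟨j, hj⟩ := List.mem_iff_getElem?.1 hS
  rw [← prems_entryRule] at hj
  simp only [Option.map_eq_some_iff] at hj
  obtain ⟨i, -, rfl⟩ := hj
  exact wellTyped_act h i

/-! #### Context occurrences -/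

end Park

/-- From the conclusion to the `j`-th premise of `r`, the formulas that follow `A` in the
conclusion belong to the context, and they correspond to those that follow `B` in the premise. -/
def Rule.KeepsCtx (r : Rule) (j : ℕ) (A B : Sequent) : Prop :=
  ∃ P, r.premAct[j]? = some P ∧ ∀ s, ∃ e,
    (A.side s).length = (r.conclAct.side s).length + e ∧
      (B.side s).length = (P.side s).length + e

namespace Park

open Sequent

variable {d : Park}

/-- The context of Park's rule is part of the context of each base rule in the derivation. The
offset in `KeepsCtx` counts formulas that are active for Park's rule but context for the base rule;
it is 0 or 1 throughout. -/
lemma keepsCtx_entryRule {j : ℕ} {i : Pos d.occs} (hi : d.entry j = some i) :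
    d.entryRule.KeepsCtx j d.rule.conclAct (d.act i) := by
  have := cutChild_eq_some hi
  obtain ⟨_ | _, _⟩ := d <;> rcases this with ⟨rfl, rfl⟩ | ⟨rfl, rfl⟩ <;>
    refine ⟨_, rfl, fun s => ?_⟩ <;> cases s <;>
    first | exact ⟨0, rfl, rfl⟩ | exact ⟨1, rfl, rfl⟩

lemma keepsCtx_posRule (h : d.rule.Correct) {i : Pos d.occs} {r : Rule}
    (hr : d.posRule i = some r) {j : ℕ} {x : Pos d.occs ⊕ ℕ} (hx : d.next i j = some x)
    {B : Sequent} (hB : target x = some B) : r.KeepsCtx j (d.act i) B := by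
  cases i
  case spec =>
    rcases j with _ | j <;> simp only [next, Option.some.injEq, reduceCtorEq] at hx
    subst hx
    cases hB
    cases hs : d.side <;> simp only [posRule, Option.some.injEq, hs] at hr <;> subst hr <;>
      refine ⟨onBoth d.side [d.fixVars] [d.invVars], by
        simp [Rule.premAct, countAt_apps_args h, onBoth, hs, fixVars, invVars], fun s => ⟨0, ?_⟩⟩ <;>
      cases s <;>
      simp [act, hs, onBoth, Rule.conclAct, Sequent.side]
  case mono =>
    simp only [next, Option.dite_none_right_eq_some, Option.some.injEq] at hx
    obtain ⟨hj, rfl⟩ := hx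
    cases hB
    have hj : j < (d.body.appVars d.vars).countAt 0 := hj
    cases hs : d.side <;> simp only [posRule, Option.some.injEq, hs] at hr <;> subst hr <;>
      refine ⟨onBoth d.side [d.fixVars] [d.invVars], by
        simp [Rule.premAct, hj, onBoth, hs, fixVars, invVars], fun s => ⟨0, ?_⟩⟩ <;>
      cases s <;>
      simp [act, hs, onBoth, Rule.conclAct, Sequent.side]
  case unfolded =>
    simp only [posRule, Option.some.injEq] at hr
    subst hr
    have := cutChild_eq_some hx
    obtain ⟨_ | _, _⟩ := d <;> rcases this with ⟨rfl, rfl⟩ | ⟨rfl, rfl⟩ <;> cases hB <;>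
      refine ⟨_, rfl, fun s => ?_⟩ <;> cases s <;> exact ⟨1, rfl, rfl⟩
  all_goals
    rcases j with _ | j <;> simp only [next, Option.some.injEq, reduceCtorEq] at hx
  all_goals
    simp only [posRule, Option.some.injEq] at hr
    subst hr hx
    obtain ⟨_ | _, _⟩ := d <;> cases hB <;> refine ⟨_, rfl, fun s => ?_⟩ <;> cases s <;>
      first | exact ⟨0, rfl, rfl⟩ | exact ⟨1, rfl, rfl⟩

end Park

/-! ### Eliminating Park's rules from a pre-proof -/

namespace PreProof

variable {R : Set Rule} (P : PreProof R)

/-- The data of Park's rule applied at a node, if there is one. -/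
def parkAt (n : P.Node) : Option Park := (P.rule n).bind Rule.park?

variable {P}

lemma rule_of_parkAt {n : P.Node} {d : Park} (h : P.parkAt n = some d) :
    P.rule n = some d.rule := by
  obtain ⟨r, hr, hd⟩ := Option.bind_eq_some_iff.1 h
  rw [hr, Rule.eq_rule_of_park? hd]

lemma not_isPark_of_parkAt {n : P.Node} (h : P.parkAt n = none) {r : Rule}
    (hr : P.rule n = some r) : ¬ r.IsPark := by
  rw [← Rule.park?_eq_none]
  simpa [parkAt, hr] using h

lemma correct_of_parkAt {n : P.Node} {d : Park} (h : P.parkAt n = some d) : d.rule.Correct :=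
  P.rule_correct n _ (rule_of_parkAt h)

lemma sequent_of_parkAt {n : P.Node} {d : Park} (h : P.parkAt n = some d) :
    P.sequent n = d.rule.concl :=
  (P.rule_concl n _ (rule_of_parkAt h)).symm

variable (P)

/-- The nodes of the proof without Park's rules: the old nodes and, for every application of one of
Park's rules, the positions of its derivation. -/
inductive ElimNode where
  | main (n : P.Node)
  | aux (n : P.Node) (d : Park) (h : P.parkAt n = some d) (i : Park.Pos d.occs)

-- The tree obtained by inserting the derivations

namespace ElimNode

open Relation

variable {P}

/-- The old node to which a node belongs. -/
def proj : P.ElimNode → P.Node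
  | main n => n
  | aux n _ _ _ => n

def child : P.ElimNode → ℕ → Option P.ElimNode
  | main n, j => match h : P.parkAt n with
    | none => (P.child n j).map main
    | some d => (d.entry j).map (aux n d h)
  | aux n d h i, j => (d.next i j).bind
      (Sum.elim (fun i' => some (aux n d h i')) fun j' => (P.child n j').map main)

def rule : P.ElimNode → Option Rule
  | main n => match P.parkAt n with
    | none => P.rule n
    | some d => some d.entryRule
  | aux _ d _ i => d.posRule i

def sequent : P.ElimNode → Sequent
  | main n => P.sequent n
  | aux _ d _ i => (d.act i).add d.ctx

/-- Every open leaf of an inserted derivation returns to the `loop` of the same derivation; old open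
leaves keep their companions. -/
def back : P.ElimNode → P.ElimNode
  | main n => main (P.back n)
  | aux n d h _ => aux n d h .loop

lemma child_main_of_none {n : P.Node} (h : P.parkAt n = none) (j : ℕ) :
    (main n).child j = (P.child n j).map main := by
  simp only [child]
  split <;> simp_all

lemma child_main_of_some {n : P.Node} {d : Park} (h : P.parkAt n = some d) (j : ℕ) :
    (main n).child j = (d.entry j).map (aux n d h) := by
  simp only [child]
  split
  · simp_all
  · next d' h' =>
    obtain rfl : d = d' := by simpa [h] using h'
    rfl

lemma rule_main_of_none {n : P.Node} (h : P.parkAt n = none) : (main n).rule = P.rule n := by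
  simp [rule, h]

lemma rule_main_of_some {n : P.Node} {d : Park} (h : P.parkAt n = some d) :
    (main n).rule = some d.entryRule := by
  simp [rule, h]

lemma child_aux_inl {n : P.Node} {d : Park} {h : P.parkAt n = some d} {i i' : Park.Pos d.occs}
    {j : ℕ} (hi : d.next i j = some (.inl i')) :
    (aux n d h i).child j = some (aux n d h i') := by
  simp [child, hi]

lemma child_aux_inr {n : P.Node} {d : Park} {h : P.parkAt n = some d} {i : Park.Pos d.occs}
    {j j' : ℕ} (hi : d.next i j = some (.inr j')) :
    (aux n d h i).child j = (P.child n j').map main := by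
  simp [child, hi]

lemma child_eq_main {q : P.ElimNode} {j : ℕ} {m : P.Node} (hq : q.child j = some (main m)) :
    (∃ n, q = main n ∧ P.parkAt n = none ∧ P.child n j = some m) ∨
      ∃ n d h i j', q = aux n d h i ∧ d.next i j = some (.inr j') ∧ P.child n j' = some m := by
  rcases q with n | ⟨n, d, h, i⟩
  · refine Or.inl ⟨n, rfl, ?_⟩
    cases h : P.parkAt n with
    | none => simpa [child_main_of_none h] using hq
    | some d => simp [child_main_of_some h] at hq
  · refine Or.inr ⟨n, d, h, i, ?_⟩
    simp only [child, Option.bind_eq_some_iff] at hq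
    obtain ⟨i' | j', hx, hq⟩ := hq
    · simp at hq
    · exact ⟨j', rfl, hx, by simpa using hq⟩

lemma child_eq_aux {q : P.ElimNode} {j : ℕ} {n : P.Node} {d : Park} {h : P.parkAt n = some d}
    {i : Park.Pos d.occs} (hq : q.child j = some (aux n d h i)) :
    (q = main n ∧ d.entry j = some i) ∨
      ∃ i', q = aux n d h i' ∧ d.next i' j = some (.inl i) := by
  rcases q with n' | ⟨n', d', h', i'⟩
  · refine Or.inl ?_
    cases h' : P.parkAt n' with
    | none => simp [child_main_of_none h'] at hq
    | some d' =>
      rw [child_main_of_some h', Option.map_eq_some_iff] at hq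
      obtain ⟨i', hi', hq⟩ := hq
      cases hq
      exact ⟨rfl, hi'⟩
  · refine Or.inr ?_
    simp only [child, Option.bind_eq_some_iff] at hq
    obtain ⟨i₁ | j', hx, hq⟩ := hq
    · cases hq
      exact ⟨i', rfl, hx⟩
    · simp at hq

lemma child_inj {q q' : P.ElimNode} {j j' : ℕ} {x : P.ElimNode} (h : q.child j = some x)
    (h' : q'.child j' = some x) : q = q' ∧ j = j' := by
  rcases x with m | ⟨n, d, hd, i⟩
  · rcases child_eq_main h with ⟨n, rfl, hn, hm⟩ | ⟨n, d, hd, i, l, rfl, hl, hm⟩ <;>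
      rcases child_eq_main h' with ⟨n', rfl, hn', hm'⟩ | ⟨n', d', hd', i', l', rfl, hl', hm'⟩ <;>
      obtain ⟨rfl, rfl⟩ := P.child_inj _ _ _ _ _ hm hm'
    · simp
    · simp [hn] at hd'
    · simp [hn'] at hd
    · obtain rfl : d = d' := by simpa [hd] using hd'
      have := (Park.parent_of_next hl).symm.trans (Park.parent_of_next hl')
      simp_all
  · rcases child_eq_aux h with ⟨rfl, hi⟩ | ⟨i₁, rfl, hi⟩ <;>
      rcases child_eq_aux h' with ⟨rfl, hi'⟩ | ⟨i₂, rfl, hi'⟩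
    · have := (Park.parent_of_entry hi).symm.trans (Park.parent_of_entry hi')
      simp_all
    · have := (Park.parent_of_entry hi).symm.trans (Park.parent_of_next hi')
      simp at this
    · have := (Park.parent_of_next hi).symm.trans (Park.parent_of_entry hi')
      simp at this
    · have := (Park.parent_of_next hi).symm.trans (Park.parent_of_next hi')
      simp_all

lemma reachable_aux {n : P.Node} {d : Park} (h : P.parkAt n = some d) (i : Park.Pos d.occs) :
    ReflTransGen (fun a b => ∃ j, child a j = some b) (main n) (aux n d h i) := by
  have hne : d.side.cutIdx ≠ d.side.other.cutIdx := by cases d.side <;> decide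
  have entry {i : Park.Pos d.occs} (j : ℕ) (hi : d.entry j = some i) :
      ReflTransGen (fun a b => ∃ j, child a j = some b) (main n) (aux n d h i) :=
    .single ⟨j, by simp [child_main_of_some h, hi]⟩
  have next {i i' : Park.Pos d.occs} (j : ℕ) (hi' : d.next i j = some (.inl i'))
      (hi : ReflTransGen (fun a b => ∃ j, child a j = some b) (main n) (aux n d h i)) :
      ReflTransGen (fun a b => ∃ j, child a j = some b) (main n) (aux n d h i') :=
    hi.tail ⟨j, child_aux_inl hi'⟩
  have spec := entry (i := .spec) d.side.other.cutIdx (by simp [Park.entry, Park.cutChild])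
  have swap := entry (i := .swap) d.side.cutIdx (by simp [Park.entry, Park.cutChild, hne])
  have loop := next (i' := .loop) 0 rfl spec
  have unfolded := next (i' := .unfolded) 0 rfl loop
  have monoSwap := next (i' := .monoSwap) d.side.other.cutIdx
    (by simp [Park.next, Park.cutChild]) unfolded
  have premSwap := next (i' := .premSwap) d.side.cutIdx
    (by simp [Park.next, Park.cutChild, hne]) unfolded
  have monoDrop := next (i' := .monoDrop) 0 rfl monoSwap
  have mono := next (i' := .mono) 0 rfl monoDrop
  cases i with
  | drop => exact next 0 rfl swap
  | premDrop => exact next 0 rfl premSwap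
  | leaf j => exact next j (by simp [Park.next]) mono
  | _ => assumption

/-- An old edge out of an application of Park's rules becomes a path through the derivation, ending
at `premDrop` for the first premise and at `drop` for the second. -/
lemma reachable_main (n : P.Node) :
    ReflTransGen (fun a b => ∃ j, child a j = some b) (main P.root) (main n) := by
  induction P.reachable n with
  | refl => exact .refl
  | @tail a b _ hb ih =>
    obtain ⟨j, hj⟩ := hb
    refine ih.trans ?_
    cases h : P.parkAt a with
    | none => exact .single ⟨j, by simp [child_main_of_none h, hj]⟩
    | some d =>
      have := P.rule_prems a _ (rule_of_parkAt h) j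
      rw [hj, Park.prems_rule] at this
      rcases j with _ | _ | j
      · exact (reachable_aux h .premDrop).tail ⟨0, (child_aux_inr rfl).trans (by simp [hj])⟩
      · exact (reachable_aux h .drop).tail ⟨0, (child_aux_inr rfl).trans (by simp [hj])⟩
      · simp at this

lemma finite : Finite P.ElimNode := by
  have := P.finite_node
  have (o : Option Park) : Finite (Σ d : {d // o = some d}, Park.Pos d.1.occs) := by
    have (k : ℕ) : Finite (Park.Pos k) := by
      refine Finite.of_surjective (α := Option (Fin 9 ⊕ Fin k)) (fun x => match x with
        | none => .spec
        | some (.inr j) => .leaf j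
        | some (.inl 0) => .swap
        | some (.inl 1) => .drop
        | some (.inl 2) => .loop
        | some (.inl 3) => .unfolded
        | some (.inl 4) => .monoSwap
        | some (.inl 5) => .monoDrop
        | some (.inl 6) => .mono
        | some (.inl 7) => .premSwap
        | some (.inl 8) => .premDrop) fun i => ?_
      cases i
      case spec => exact ⟨none, rfl⟩
      case leaf j => exact ⟨some (.inr j), rfl⟩
      case swap => exact ⟨some (.inl 0), rfl⟩
      case drop => exact ⟨some (.inl 1), rfl⟩
      case loop => exact ⟨some (.inl 2), rfl⟩
      case unfolded => exact ⟨some (.inl 3), rfl⟩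
      case monoSwap => exact ⟨some (.inl 4), rfl⟩
      case monoDrop => exact ⟨some (.inl 5), rfl⟩
      case mono => exact ⟨some (.inl 6), rfl⟩
      case premSwap => exact ⟨some (.inl 7), rfl⟩
      case premDrop => exact ⟨some (.inl 8), rfl⟩
    -- A node carries at most one Park instance, so the index type of the sum is finite although
    -- `Park` is not.
    have : Subsingleton {d // o = some d} :=
      ⟨fun a b => Subtype.ext (Option.some.inj (a.2.symm.trans b.2))⟩
    infer_instance
  refine Finite.of_surjective
    (α := P.Node ⊕ Σ n, Σ d : {d // P.parkAt n = some d}, Park.Pos d.1.occs)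
    (Sum.elim main fun x => aux x.1 x.2.1.1 x.2.1.2 x.2.2) fun q => ?_
  rcases q with n | ⟨n, d, h, i⟩
  · exact ⟨.inl n, rfl⟩
  · exact ⟨.inr ⟨n, ⟨d, h⟩, i⟩, rfl⟩

end ElimNode

open ElimNode in
/-- The pre-proof in which every application of one of Park's rules is replaced by a derivation. -/
def elim : PreProof baseRules where
  Node := P.ElimNode
  finite_node := ElimNode.finite
  root := main P.root
  child := ElimNode.child
  child_ne_root q j h := by
    rcases child_eq_main h with ⟨n, -, -, h⟩ | ⟨n, -, -, -, j', -, -, h⟩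
    · exact P.child_ne_root n j h
    · exact P.child_ne_root n j' h
  child_inj _ _ _ _ _ := ElimNode.child_inj
  reachable q := by
    rcases q with n | ⟨n, d, h, i⟩
    · exact reachable_main n
    · exact (reachable_main n).trans (reachable_aux h i)
  sequent := ElimNode.sequent
  rule := ElimNode.rule
  rule_mem q r hr := by
    rcases q with n | ⟨n, d, h, i⟩
    · cases h : P.parkAt n with
      | none => exact not_isPark_of_parkAt h (by rwa [rule_main_of_none h] at hr)
      | some d =>
        rw [rule_main_of_some h] at hr
        cases hr
        exact id
    · exact Park.not_isPark_posRule hr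
  rule_correct q r hr := by
    rcases q with n | ⟨n, d, h, i⟩
    · cases h : P.parkAt n with
      | none => exact P.rule_correct n r (by rwa [rule_main_of_none h] at hr)
      | some d =>
        rw [rule_main_of_some h] at hr
        cases hr
        exact d.correct_entryRule (correct_of_parkAt h)
    · exact Park.correct_posRule (correct_of_parkAt h) hr
  rule_concl q r hr := by
    rcases q with n | ⟨n, d, h, i⟩
    · cases h : P.parkAt n with
      | none => exact P.rule_concl n r (by rwa [rule_main_of_none h] at hr)
      | some d =>
        rw [rule_main_of_some h] at hr
        cases hr
        exact (sequent_of_parkAt h).symm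
    · exact Park.concl_posRule (correct_of_parkAt h) hr
  rule_prems q r hr j := by
    rcases q with n | ⟨n, d, h, i⟩
    · cases h : P.parkAt n with
      | none =>
        rw [child_main_of_none h, Option.map_map]
        exact P.rule_prems n r (by rwa [rule_main_of_none h] at hr) j
      | some d =>
        rw [rule_main_of_some h] at hr
        cases hr
        rw [child_main_of_some h, Option.map_map, ← d.prems_entryRule]
        rfl
    · rw [← Park.prems_posRule (correct_of_parkAt h) hr, ElimNode.child, Option.map_bind]
      congr 1
      funext x
      rcases x with i' | j'
      · rfl
      · have := P.rule_prems n _ (rule_of_parkAt h) j'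
        simp only [Rule.prems, List.getElem?_map, Park.premCtx_rule] at this
        simp only [Function.comp, Sum.elim_inr, Option.map_map, Park.target, ← this]
        rfl
  open_leaf q hq j := by
    rcases q with n | ⟨n, d, h, i⟩
    · cases h : P.parkAt n with
      | none => rw [child_main_of_none h, P.open_leaf n (by rwa [rule_main_of_none h] at hq)]; rfl
      | some d => simp [rule_main_of_some h] at hq
    · cases i <;> simp only [ElimNode.rule, Park.posRule, reduceCtorEq] at hq
      rfl
  back := ElimNode.back
  back_sequent q hq := by
    rcases q with n | ⟨n, d, h, i⟩
    · cases h : P.parkAt n with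
      | none => exact P.back_sequent n (by rwa [rule_main_of_none h] at hq)
      | some d => simp [rule_main_of_some h] at hq
    · cases i <;> simp only [ElimNode.rule, Park.posRule, reduceCtorEq] at hq
      rfl
  back_nonleaf q hq := by
    rcases q with n | ⟨n, d, h, i⟩
    · cases h : P.parkAt n with
      | none =>
        obtain ⟨j, m, hm⟩ := P.back_nonleaf n (by rwa [rule_main_of_none h] at hq)
        -- The companion may itself be an application of Park's rules; it then has the premises of
        -- the outer cut as children.
        cases h' : P.parkAt (P.back n) with
        | none => exact ⟨j, main m, by simp [ElimNode.back, child_main_of_none h', hm]⟩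
        | some d =>
          refine ⟨d.side.other.cutIdx, aux _ d h' .spec, ?_⟩
          simp [ElimNode.back, child_main_of_some h', Park.entry, Park.cutChild]
      | some d => simp [rule_main_of_some h] at hq
    · exact ⟨0, aux n d h .unfolded, rfl⟩

end PreProof

/-! ### Lifting traces -/

lemma Sequent.at_add (A C : Sequent) (s : Side) (e : ℕ) :
    (A.add C).at ⟨s, (A.side s).length + e⟩ = (C.side s)[e]? := by
  cases s <;> simp [Sequent.at, Sequent.add, Sequent.side, List.getElem?_append_right]

lemma Rule.not_principal_ctx (r : Rule) (s : Side) (e : ℕ) :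
    ¬ r.Principal ⟨s, (r.conclAct.side s).length + e⟩ := by
  simp [Principal]

lemma Rule.annotate_ctx (r : Rule) (j : ℕ) (s : Side) (e : ℕ) (o' : Occ) (k : ℕ) (φ : Fm)
    (a : AFm) : r.annotate j ⟨s, (r.conclAct.side s).length + e⟩ o' k φ a = Expr.relabel φ a :=
  if_neg (r.not_principal_ctx s e)

namespace PreProof

variable {R : Set Rule} {P : PreProof R}

lemma relevant_ctx {n m : P.Node} {r : Rule} {j : ℕ} {A : Sequent} (hr : P.rule n = some r)
    (hm : P.child n j = some m) (hA : r.premAct[j]? = some A) (s : Side) (e : ℕ) :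
    P.Relevant n m ⟨s, (r.conclAct.side s).length + e⟩ ⟨s, (A.side s).length + e⟩ :=
  Or.inr ⟨r, j, hr, hm, rfl, A, hA, Or.inl ⟨e, rfl, rfl⟩⟩

lemma annStep_ctx {n m : P.Node} {r : Rule} {j : ℕ} {A : Sequent} (hr : P.rule n = some r)
    (hm : P.child n j = some m) {s : Side} {e : ℕ} {φ : Fm}
    (hφ : (P.sequent m).at ⟨s, (A.side s).length + e⟩ = some φ) (k : ℕ) (a : AFm) :
    P.AnnStep n m ⟨s, (r.conclAct.side s).length + e⟩ ⟨s, (A.side s).length + e⟩ k a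
      (Expr.relabel φ a) :=
  Or.inr ⟨r, j, φ, hr, hm, hφ, (r.annotate_ctx ..).symm⟩

lemma relevant_of_keepsCtx {n m : P.Node} {r : Rule} {j : ℕ} {A B : Sequent}
    (hr : P.rule n = some r) (hm : P.child n j = some m) (h : r.KeepsCtx j A B) (s : Side) (e : ℕ) :
    P.Relevant n m ⟨s, (A.side s).length + e⟩ ⟨s, (B.side s).length + e⟩ := by
  obtain ⟨D, hD, h⟩ := h
  obtain ⟨f, h₁, h₂⟩ := h s
  rw [h₁, h₂, add_assoc, add_assoc]
  exact relevant_ctx hr hm hD s (f + e)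

lemma annStep_of_keepsCtx {n m : P.Node} {r : Rule} {j : ℕ} {A B : Sequent}
    (hr : P.rule n = some r) (hm : P.child n j = some m) (h : r.KeepsCtx j A B) {s : Side} {e : ℕ}
    {φ : Fm} (hφ : (P.sequent m).at ⟨s, (B.side s).length + e⟩ = some φ) (k : ℕ) (a : AFm) :
    P.AnnStep n m ⟨s, (A.side s).length + e⟩ ⟨s, (B.side s).length + e⟩ k a
      (Expr.relabel φ a) := by
  obtain ⟨D, -, h⟩ := h
  obtain ⟨f, h₁, h₂⟩ := h s
  rw [h₂, add_assoc] at hφ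
  rw [h₁, h₂, add_assoc, add_assoc]
  exact annStep_ctx hr hm hφ k a

lemma sequent_child_of_parkAt {n m : P.Node} {d : Park} (h : P.parkAt n = some d) {j : ℕ}
    {B : Sequent} (hm : P.child n j = some m) (hB : d.rule.premAct[j]? = some B) :
    P.sequent m = B.add d.ctx := by
  have := P.rule_prems n _ (rule_of_parkAt h) j
  simpa [hm, Rule.prems, hB, Park.premCtx_rule] using this

/-- Only occurrences in the context have relevant occurrences in the premises of Park's rules. -/
lemma relevant_of_parkAt {n m : P.Node} {d : Park} (h : P.parkAt n = some d) {o o' : Occ}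
    (ho : P.Relevant n m o o') : ∃ j B s e, P.child n j = some m ∧ d.rule.premAct[j]? = some B ∧
      o = ⟨s, (d.rule.conclAct.side s).length + e⟩ ∧ o' = ⟨s, (B.side s).length + e⟩ := by
  have hr := rule_of_parkAt h
  rcases ho with ⟨hn, -⟩ | ⟨r, j, hr', hm, hs, B, hB, h⟩
  · simp [hr] at hn
  · obtain rfl : d.rule = r := by simpa [hr] using hr'
    rcases h with ⟨e, h₁, h₂⟩ | ⟨-, -, h⟩
    · exact ⟨j, B, o.side, e, hm, hB, Occ.ext rfl h₁, Occ.ext hs h₂⟩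
    · obtain ⟨_ | _, _⟩ := d <;> exact h.elim

lemma annStep_of_parkAt {n m : P.Node} {d : Park} (h : P.parkAt n = some d) {s : Side} {e : ℕ}
    {o' : Occ} {φ : Fm} (hφ : (P.sequent m).at o' = some φ) {k : ℕ} {a a' : AFm}
    (ha : P.AnnStep n m ⟨s, (d.rule.conclAct.side s).length + e⟩ o' k a a') :
    a' = Expr.relabel φ a := by
  have hr := rule_of_parkAt h
  rcases ha with ⟨hn, -⟩ | ⟨r, j, φ', hr', hm, hφ', ha⟩
  · simp [hr] at hn
  · obtain rfl : d.rule = r := by simpa [hr] using hr'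
    obtain rfl : φ = φ' := by simpa [hφ] using hφ'
    rwa [Rule.annotate_ctx] at ha

end PreProof

/-- The steps that a path can make inside the derivation of one of Park's rules. -/
def Park.Step {d : Park} (i i' : Park.Pos d.occs) : Prop :=
  (∃ j, d.next i j = some (.inl i')) ∨ (∃ j, i = .leaf j) ∧ i' = .loop

/-- The only unfolding in the derivation takes place at `loop`, and it acts on the fixed-point
formula, never on the context. Lifted traces thus acquire no new unfoldings. -/
lemma Park.not_principal_of_isFix {d : Park} {i : Park.Pos d.occs} {r : Rule}
    (hr : d.posRule i = some r) (hf : r.IsFix) (s : Side) (e : ℕ) :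
    ¬ r.Principal ⟨s, ((d.act i).side s).length + e⟩ := by
  obtain ⟨_ | _, _⟩ := d <;> cases i <;>
    simp only [posRule, Option.some.injEq, reduceCtorEq] at hr <;> subst hr <;>
    first
    | exact hf.elim
    | cases s <;> simp [Rule.Principal, Rule.conclAct, Sequent.side, Sequent.on, act,
        Sequent.onBoth]

-- Correspondence between new and old steps

namespace PreProof

variable {R : Set Rule} {P : PreProof R}

namespace ElimNode

/-- The old nodes. -/
def IsMain : P.ElimNode → Prop
  | main _ => True
  | aux _ _ _ _ => False

/-- The occurrence of a context formula of one of Park's rules at a position in its derivation. -/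
def occ : P.ElimNode → Occ → Occ
  | main _, o => o
  | aux _ d _ i, o =>
    ⟨o.side, ((d.act i).side o.side).length + (o.idx - (d.rule.conclAct.side o.side).length)⟩

/-- The annotation of the context formula `φ` of one of Park's rules at a position in its
derivation. -/
def ann : P.ElimNode → Fm → AFm → AFm
  | main _, _, a => a
  | aux _ _ _ _, φ, a => Expr.relabel φ a

lemma occ_aux (n : P.Node) (d : Park) (h : P.parkAt n = some d) (i : Park.Pos d.occs) (s : Side)
    (e : ℕ) : (aux n d h i).occ ⟨s, (d.rule.conclAct.side s).length + e⟩ =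
      ⟨s, ((d.act i).side s).length + e⟩ := by
  simp [occ]

lemma edge_main {q : P.ElimNode} {m : P.Node} (h : P.elim.Edge q (main m)) : P.Edge q.proj m := by
  rcases h with ⟨hr, hm⟩ | ⟨j, hj⟩
  · rcases q with n | ⟨n, d, h, i⟩
    · cases h : P.parkAt n with
      | none =>
        cases hm
        exact Or.inl ⟨(rule_main_of_none h).symm.trans hr, rfl⟩
      | some d => exact absurd ((rule_main_of_some h).symm.trans hr) (by simp)
    · cases hm
  · rcases child_eq_main hj with ⟨n, rfl, -, h⟩ | ⟨n, d, hd, i, j', rfl, -, h⟩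
    · exact Or.inr ⟨j, h⟩
    · exact Or.inr ⟨j', h⟩

/-- An inserted derivation can be entered only through its conclusion, since its open leaves return
inside it. -/
lemma edge_aux {q : P.ElimNode} {n : P.Node} {d : Park} {h : P.parkAt n = some d}
    {i : Park.Pos d.occs} (hq : P.elim.Edge q (aux n d h i)) :
    (q = main n ∧ ∃ j, d.entry j = some i) ∨ ∃ i', q = aux n d h i' ∧ Park.Step i' i := by
  rcases hq with ⟨hr, hm⟩ | ⟨j, hj⟩
  · rcases q with n' | ⟨n', d', h', i'⟩
    · cases hm
    · cases hm
      refine Or.inr ⟨i', rfl, Or.inr ⟨?_, rfl⟩⟩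
      cases i' <;> simp [elim, rule, Park.posRule] at hr ⊢
  · rcases child_eq_aux hj with ⟨rfl, h⟩ | ⟨i', rfl, h⟩
    · exact Or.inl ⟨rfl, j, h⟩
    · exact Or.inr ⟨i', rfl, Or.inl ⟨j, h⟩⟩

lemma exists_posRule_of_next {d : Park} {i : Park.Pos d.occs} {j : ℕ} {x : Park.Pos d.occs ⊕ ℕ}
    (h : d.next i j = some x) : ∃ r, d.posRule i = some r := by
  cases i <;> first | exact ⟨_, rfl⟩ | simp [Park.next] at h

lemma sequent_aux_at (n : P.Node) (d : Park) (h : P.parkAt n = some d) (i : Park.Pos d.occs)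
    (s : Side) (e : ℕ) : (P.elim.sequent (aux n d h i)).at ⟨s, ((d.act i).side s).length + e⟩ =
      (d.ctx.side s)[e]? :=
  Sequent.at_add _ _ _ _

/-- A step inside the derivation of one of Park's rules. -/
lemma step_aux {q : P.ElimNode} {n : P.Node} {d : Park} {h : P.parkAt n = some d}
    {i : Park.Pos d.occs} (hq : P.elim.Edge q (aux n d h i)) {s : Side} {e : ℕ} {φ : Fm}
    (hφ : (d.ctx.side s)[e]? = some φ) {o : Occ}
    (ho : o = ⟨s, (d.rule.conclAct.side s).length + e⟩) :
    P.elim.Relevant q (aux n d h i) (q.occ o) ((aux n d h i).occ o) ∧ ∀ k a,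
      P.elim.AnnStep q (aux n d h i) (q.occ o) ((aux n d h i).occ o) k (q.ann φ a)
        (Expr.relabel φ a) := by
  subst ho
  have hat := (sequent_aux_at n d h i s e).trans hφ
  -- At the conclusion the annotation has not yet been relabelled, at a position it has; the next
  -- relabelling gives the same result.
  have hrel (a : AFm) : Expr.relabel φ a = Expr.relabel φ (q.ann φ a) := by
    cases q
    · rfl
    · exact (Expr.relabel_relabel φ a).symm
  rw [occ_aux]
  rcases edge_aux hq with ⟨rfl, j, hj⟩ | ⟨i', rfl, ⟨j, hj⟩ | ⟨⟨j, rfl⟩, rfl⟩⟩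
  · have hr : P.elim.rule (main n) = some d.entryRule := rule_main_of_some h
    have hc : P.elim.child (main n) j = some (aux n d h i) := by
      simp [elim, child_main_of_some h, hj]
    have hk := Park.keepsCtx_entryRule hj
    exact ⟨relevant_of_keepsCtx hr hc hk s e,
      fun k a => hrel a ▸ annStep_of_keepsCtx hr hc hk hat k a⟩
  · obtain ⟨r, hr⟩ := exists_posRule_of_next hj
    have hr' : P.elim.rule (aux n d h i') = some r := hr
    have hk := Park.keepsCtx_posRule (correct_of_parkAt h) hr hj rfl
    rw [occ_aux]
    refine ⟨relevant_of_keepsCtx (P := P.elim) hr' (child_aux_inl hj) hk s e, fun k a => ?_⟩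
    rw [hrel a]
    exact annStep_of_keepsCtx (P := P.elim) hr' (child_aux_inl hj) hk hat k _
  · rw [occ_aux]
    exact ⟨Or.inl ⟨rfl, rfl, rfl⟩, fun k a => Or.inl ⟨rfl, rfl⟩⟩

/-- A step from the derivation of one of Park's rules to one of its premises. -/
lemma step_main {q : P.ElimNode} {m : P.Node} (hq : P.elim.Edge q (main m)) {d : Park}
    (h : P.parkAt q.proj = some d) {j : ℕ} {B : Sequent} (hm : P.child q.proj j = some m)
    (hB : d.rule.premAct[j]? = some B) {s : Side} {e : ℕ} {φ : Fm}
    (hφ : (d.ctx.side s)[e]? = some φ) :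
    P.elim.Relevant q (main m) (q.occ ⟨s, (d.rule.conclAct.side s).length + e⟩)
      ⟨s, (B.side s).length + e⟩ ∧ ∀ k a,
      P.elim.AnnStep q (main m) (q.occ ⟨s, (d.rule.conclAct.side s).length + e⟩)
        ⟨s, (B.side s).length + e⟩ k (q.ann φ a) (Expr.relabel φ a) := by
  rcases hq with ⟨hr, hm'⟩ | ⟨l, hl⟩
  · rcases q with n | ⟨n, d, h, i⟩
    · exact absurd ((rule_main_of_some h).symm.trans hr) (by simp)
    · cases hm'
  · rcases child_eq_main hl with ⟨n, rfl, h', -⟩ | ⟨n, d', hd, i, j', rfl, hi, hm'⟩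
    · exact absurd (h.symm.trans h') (by simp)
    · obtain rfl : d' = d := by simpa using hd.symm.trans h
      obtain rfl : j = j' := (P.child_inj _ _ _ _ _ hm hm').2
      obtain ⟨r, hr⟩ := exists_posRule_of_next hi
      have hr' : P.elim.rule (aux n d' h i) = some r := hr
      have hk := Park.keepsCtx_posRule (correct_of_parkAt h) hr hi hB
      rw [occ_aux]
      refine ⟨relevant_of_keepsCtx (P := P.elim) hr' hl hk s e, fun k a => ?_⟩
      rw [← Expr.relabel_relabel]
      refine annStep_of_keepsCtx (P := P.elim) hr' hl hk ?_ k _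
      change (P.sequent m).at _ = _
      rw [sequent_child_of_parkAt h hm hB, Sequent.at_add, hφ]

lemma relevant_main {n m : P.Node} (h : P.parkAt n = none) {o o' : Occ} (ho : P.Relevant n m o o') :
    P.elim.Relevant (main n) (main m) o o' := by
  have hrule : P.elim.rule (main n) = P.rule n := rule_main_of_none h
  rcases ho with ⟨hr, rfl, rfl⟩ | ⟨r, j, hr, hm, ho⟩
  · exact Or.inl ⟨hrule.trans hr, rfl, rfl⟩
  · exact Or.inr ⟨r, j, hrule.trans hr,
      (child_main_of_none h j).trans (congrArg (Option.map main) hm), ho⟩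

lemma annStep_main {n m : P.Node} (h : P.parkAt n = none) {o o' : Occ} {k : ℕ} {a a' : AFm}
    (ha : P.AnnStep n m o o' k a a') : P.elim.AnnStep (main n) (main m) o o' k a a' := by
  have hrule : P.elim.rule (main n) = P.rule n := rule_main_of_none h
  rcases ha with ⟨hr, rfl⟩ | ⟨r, j, φ, hr, hm, hφ, ha⟩
  · exact Or.inl ⟨hrule.trans hr, rfl⟩
  · exact Or.inr ⟨r, j, φ, hrule.trans hr,
      (child_main_of_none h j).trans (congrArg (Option.map main) hm), hφ, ha⟩

lemma logicalAt_main {n : P.Node} {o : Occ} (h : P.LogicalAt n o) :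
    P.elim.LogicalAt (main n) o := by
  obtain ⟨r, hr, hl, ho⟩ := h
  refine ⟨r, (rule_main_of_none ?_).trans hr, hl, ho⟩
  rw [parkAt, hr]
  cases r <;> first | rfl | exact hl.elim

/-- Unfoldings along a lifted trace happen only at old nodes, so the numbers chosen for the old
trace remain pairwise different. -/
lemma fixAt_of_elim {q : P.ElimNode} {o : Occ} (hq : P.elim.FixAt q (q.occ o))
    (ho : ∀ d, P.parkAt q.proj = some d →
      ∃ s e, o = ⟨s, (d.rule.conclAct.side s).length + e⟩) : q.IsMain ∧ P.FixAt q.proj o := by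
  obtain ⟨r, hr, hf, hp⟩ := hq
  rcases q with n | ⟨n, d, h, i⟩
  · refine ⟨trivial, ?_⟩
    cases h : P.parkAt n with
    | none => exact ⟨r, (rule_main_of_none h).symm.trans hr, hf, hp⟩
    | some d =>
      cases (rule_main_of_some h).symm.trans hr
      exact hf.elim
  · obtain ⟨s, e, rfl⟩ := ho d h
    rw [occ_aux] at hp
    exact absurd hp (Park.not_principal_of_isFix hr hf s e)

end ElimNode

open ElimNode

/-- Lifting a trace. The function `c` sends a time to the number of steps made between old nodes. -/
lemma IsFixTrace.elim {σ : FixOp} {π : ℕ → P.ElimNode} {ρ : ℕ → P.Node} {c : ℕ → ℕ} {τ : ℕ → Occ}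
    (hτ : P.IsFixTrace σ ρ τ) (hπ : P.elim.IsPath π) (hρ : ∀ i, (π i).proj = ρ (c i))
    (h0 : (π 0).IsMain) (hc0 : c 0 = 0)
    (hmain : ∀ i, (π (i + 1)).IsMain → c (i + 1) = c i + 1)
    (haux : ∀ i, ¬ (π (i + 1)).IsMain → c (i + 1) = c i)
    (hsurj : ∀ i, ∃ l, c l = i ∧ (π l).IsMain) :
    ∃ τ', τ' 0 = τ 0 ∧ P.elim.IsFixTrace σ π τ' := by
  obtain ⟨⟨⟨hsome, hrel⟩, hlog⟩, k, a, ⟨hinit, hstep, hfresh⟩, p, hp⟩ := hτ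
  have occ_main {i : ℕ} (h : (π i).IsMain) (o : Occ) : (π i).occ o = o := by
    cases hq : π i <;> simp_all [IsMain, occ]
  have ann_main {i : ℕ} (h : (π i).IsMain) (φ : Fm) (a : AFm) : (π i).ann φ a = a := by
    cases hq : π i <;> simp_all [IsMain, ann]
  have eq_main {i : ℕ} (h : (π i).IsMain) : π i = main (ρ (c i)) := by
    rw [← hρ]
    cases hq : π i <;> simp_all [IsMain, proj]
  choose φ hφ using fun i => Option.isSome_iff_exists.1 (hsome i)
  have ctx (i : ℕ) {d : Park} (h : P.parkAt (ρ i) = some d) :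
      ∃ j B s e, P.child (ρ i) j = some (ρ (i + 1)) ∧ d.rule.premAct[j]? = some B ∧
        τ i = ⟨s, (d.rule.conclAct.side s).length + e⟩ ∧
        τ (i + 1) = ⟨s, (B.side s).length + e⟩ ∧ (d.ctx.side s)[e]? = some (φ i) ∧
        φ (i + 1) = φ i := by
    obtain ⟨j, B, s, e, hm, hB, h₁, h₂⟩ := relevant_of_parkAt h (hrel i)
    have h₃ := hφ i
    rw [sequent_of_parkAt h, h₁, Rule.concl, Sequent.at_add, Park.conclCtx_rule] at h₃
    have h₄ := hφ (i + 1)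
    rw [sequent_child_of_parkAt h hm hB, h₂, Sequent.at_add, h₃] at h₄
    exact ⟨j, B, s, e, hm, hB, h₁, h₂, h₃, (Option.some.inj h₄).symm⟩
  have step (i : ℕ) : P.elim.Relevant (π i) (π (i + 1)) ((π i).occ (τ (c i)))
      ((π (i + 1)).occ (τ (c (i + 1)))) ∧
      P.elim.AnnStep (π i) (π (i + 1)) ((π i).occ (τ (c i))) ((π (i + 1)).occ (τ (c (i + 1))))
        (k (c i)) ((π i).ann (φ (c i)) (a (c i)))
        ((π (i + 1)).ann (φ (c (i + 1))) (a (c (i + 1)))) := by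
    by_cases hi : (π (i + 1)).IsMain
    · rw [occ_main hi, ann_main hi]
      have hq := hπ i
      rw [eq_main hi] at hq ⊢
      rw [hmain i hi] at hq ⊢
      -- Without a Park rule the step into an old node is a step of the old proof; with one, the
      -- path leaves the derivation through a premise.
      cases h : P.parkAt (π i).proj with
      | none =>
        have hi' : (π i).IsMain := by
          cases hq : π i with
          | main => trivial
          | aux n d h' i => simp [hq, proj, h'] at h
        rw [occ_main hi', ann_main hi', eq_main hi']
        rw [hρ] at h
        exact ⟨relevant_main h (hrel _), annStep_main h (hstep _)⟩
      | some d =>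
        have h' := h
        rw [hρ] at h'
        obtain ⟨j, B, s, e, hm, hB, h₁, h₂, h₃, h₄⟩ := ctx _ h'
        have hstep' := hstep (c i)
        rw [h₁] at hstep'
        -- The old step relabels the unchanged context formula, which is also the effect of the
        -- whole passage through the derivation.
        rw [annStep_of_parkAt h' (hφ _) hstep', h₁, h₂, h₄]
        have := step_main hq h (by rwa [hρ]) hB h₃
        exact ⟨this.1, this.2 _ _⟩
    · rw [haux i hi]
      cases hq : π (i + 1) with
      | main => simp [hq, IsMain] at hi
      | aux n d h l =>
        have hn : n = ρ (c i) := by rw [← haux i hi, ← hρ, hq, proj]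
        obtain ⟨j, B, s, e, -, -, h₁, -, h₃, -⟩ := ctx (c i) (hn ▸ h)
        have := step_aux (hq ▸ hπ i) h₃ h₁
        exact ⟨this.1, this.2 _ _⟩
  have le (i : ℕ) : c i ≤ i := by
    induction i with
    | zero => exact hc0.le
    | succ i ih =>
      by_cases hi : (π (i + 1)).IsMain <;> simp only [hmain, haux, hi, not_false_eq_true] <;> omega
  have mono : Monotone c := monotone_nat_of_le_succ fun i => by
    by_cases hi : (π (i + 1)).IsMain <;> simp only [hmain, haux, hi, not_false_eq_true] <;> omega
  -- Each arrival at an old node increases `c`, so `c` is injective on the times at which old nodes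
  -- are visited; this transfers freshness of the numbers.
  have lt {i i' : ℕ} (hi' : (π i').IsMain) (h : i < i') : c i < c i' := by
    obtain ⟨l, rfl⟩ := Nat.exists_eq_succ_of_ne_zero (Nat.ne_zero_of_lt h)
    have := mono (Nat.lt_succ_iff.1 h)
    rw [Nat.succ_eq_add_one, hmain l hi']
    omega
  refine ⟨fun i => (π i).occ (τ (c i)), by simp only [occ_main h0, hc0], ⟨⟨fun i => ?_,
    fun i => (step i).1⟩, fun N => ?_⟩, fun i => k (c i), fun i => (π i).ann (φ (c i)) (a (c i)),
    ⟨?_, fun i => (step i).2, fun i hi i' hi' hk => ?_⟩, p, fun n => ?_⟩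
  · cases hq : π i with
    | main n =>
      have := hsome (c i)
      rw [← hρ, hq] at this
      simp only [hq]
      exact this
    | aux n d h l =>
      have hn : n = ρ (c i) := by rw [← hρ, hq, proj]
      obtain ⟨j, B, s, e, -, -, h₁, -, h₃, -⟩ := ctx (c i) (hn ▸ h)
      simp only [hq, h₁, occ_aux]
      rw [sequent_aux_at, h₃]
      rfl
  · obtain ⟨i, hi, hl⟩ := hlog N
    obtain ⟨l, rfl, hl'⟩ := hsurj i
    refine ⟨l, hi.trans (le l), ?_⟩
    simp only [occ_main hl']
    rw [eq_main hl']
    exact logicalAt_main hl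
  · obtain ⟨φ, hφ, ha⟩ := hinit
    refine ⟨φ, ?_, ?_⟩
    · simp only [occ_main h0, hc0]
      rw [eq_main h0, hc0]
      exact hφ
    · simp only [ann_main h0, hc0, ha]
  · have fix {i : ℕ} (hi : P.elim.FixAt (π i) ((π i).occ (τ (c i)))) :
        (π i).IsMain ∧ P.FixAt (ρ (c i)) (τ (c i)) := by
      rw [← hρ]
      refine fixAt_of_elim hi fun d hd => ?_
      rw [hρ] at hd
      obtain ⟨j, B, s, e, -, -, h₁, -⟩ := ctx (c i) hd
      exact ⟨s, e, h₁⟩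
    obtain ⟨h₁, h₂⟩ := fix hi
    obtain ⟨h₁', h₂'⟩ := fix hi'
    have := hfresh h₂ h₂' hk
    by_contra hne
    rcases lt_or_gt_of_ne hne with h | h
    · exact (lt h₁' h).ne this
    · exact (lt h₁ h).ne' this
  · obtain ⟨i, hi⟩ := hp n
    obtain ⟨l, rfl, hl⟩ := hsurj i
    exact ⟨l, by simpa only [ann_main hl] using hi⟩

end PreProof

/-! ### The trace along the cycle -/

namespace Park

variable {d : Park}

/-- A measure that decreases along the steps until the position `loop` is reached. -/
def Pos.rank {k : ℕ} : Pos k → ℕ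
  | .loop | .drop | .premDrop => 0
  | .spec | .swap | .premSwap | .leaf _ => 1
  | .mono => 2
  | .monoDrop => 3
  | .monoSwap => 4
  | .unfolded => 5

/-- The positions on the cycle. -/
def Pos.OnCycle {k : ℕ} : Pos k → Prop
  | .loop | .unfolded | .monoSwap | .monoDrop | .mono | .leaf _ => True
  | _ => False

/-- The possible successors of a position. -/
def Pos.Succ {k : ℕ} (i i' : Pos k) : Prop :=
  match i with
  | .spec => i' = .loop
  | .swap => i' = .drop
  | .loop => i' = .unfolded
  | .unfolded => i' = .monoSwap ∨ i' = .premSwap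
  | .monoSwap => i' = .monoDrop
  | .monoDrop => i' = .mono
  | .mono => ∃ j, i' = .leaf j
  | .leaf _ => i' = .loop
  | .premSwap => i' = .premDrop
  | .drop | .premDrop => False

lemma Step.succ {i i' : Pos d.occs} (h : Step i i') : i.Succ i' := by
  rcases h with ⟨j, h⟩ | ⟨⟨j, rfl⟩, rfl⟩
  · cases i
    case mono =>
      simp only [next, Option.dite_none_right_eq_some, Option.some.injEq, Sum.inl.injEq] at h
      obtain ⟨hj, rfl⟩ := h
      exact ⟨_, rfl⟩
    case unfolded => rcases cutChild_eq_some h with ⟨h, -⟩ | ⟨h, -⟩ <;> cases h <;> simp [Pos.Succ]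
    all_goals
      rcases j with _ | j <;> simp only [next, Option.some.injEq, Sum.inl.injEq, reduceCtorEq] at h
    all_goals exact h.symm
  · rfl

lemma Step.rank_lt {i i' : Pos d.occs} (h : Step i i') (hi : i ≠ .loop) : i'.rank < i.rank := by
  have := h.succ
  cases i <;> simp only [Pos.Succ] at this
  case unfolded => rcases this with rfl | rfl <;> simp [Pos.rank]
  case mono => obtain ⟨_, rfl⟩ := this; exact Nat.one_lt_two
  case loop => exact absurd rfl hi
  all_goals subst this; simp [Pos.rank]

/-- Away from `loop` every step lowers `Pos.rank`, which cannot go on forever. -/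
lemma exists_loop {g : ℕ → Pos d.occs} (hg : ∀ i, Step (g i) (g (i + 1))) (i : ℕ) :
    ∃ l, i ≤ l ∧ g l = .loop := by
  by_cases hi : g i = .loop
  · exact ⟨i, le_rfl, hi⟩
  · obtain ⟨l, hl, h⟩ := exists_loop hg (i + 1)
    exact ⟨l, by omega, h⟩
termination_by (g i).rank
decreasing_by exact (hg i).rank_lt hi

lemma onCycle_of_step {g : ℕ → Pos d.occs} (hg : ∀ i, Step (g i) (g (i + 1))) (h0 : g 0 = .loop)
    (i : ℕ) : (g i).OnCycle := by
  induction i with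
  | zero => rw [h0]; trivial
  | succ i ih =>
    have h₁ := (hg i).succ
    have h₂ := (hg (i + 1)).succ
    have h₃ := (hg (i + 2)).succ
    cases h : g i <;> simp only [h, Pos.Succ] at h₁ <;> rw [h] at ih <;> try exact ih.elim
    case unfolded =>
      rcases h₁ with h₁ | h₁
      · rw [h₁]; trivial
      -- The branch through `premSwap` reaches `premDrop`, whose only child is a premise of Park's
      -- rule, so an infinite path inside the derivation cannot take it.
      · simp only [h₁, Pos.Succ] at h₂
        simp only [h₂, Pos.Succ] at h₃
    case mono => obtain ⟨j, h₁⟩ := h₁; rw [h₁]; trivial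
    all_goals rw [h₁]; trivial

variable (d)

/-- The fixed-point formula with the label `p`. -/
def annFix (p : List ℕ) : AFm := .fix d.side.op p d.ty (d.body.map fun _ => [])

/-- The annotated formula at a position on the cycle. -/
def annAt (p : List ℕ) : Pos d.occs → AFm
  | .loop | .leaf _ => (d.annFix p).appVars d.vars
  | _ => ((d.body.map fun _ => []).inst (d.annFix p)).appVars d.vars

variable {d}

/-- Between the unfolding and (Mono) the trace formula is a context formula and gets relabelled;
typing ensures that no label is lost. -/
lemma relabel_unfVars (h : d.rule.Correct) (p : List ℕ) :
    Expr.relabel d.unfVars (((d.body.map fun _ => []).inst (d.annFix p)).appVars d.vars) =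
      ((d.body.map fun _ => []).inst (d.annFix p)).appVars d.vars := by
  have he : (((d.body.map fun _ => []).inst (d.annFix p)).appVars d.vars).map (fun _ => ()) =
      d.unfVars := by
    rw [Expr.map_appVars, Expr.inst, Expr.map_instAt, Expr.map_map_unit, annFix, Expr.map,
      Expr.map_map_unit]
    rfl
  have ht : HasType [] d.unfVars (.pred .omega) :=
    (wellTyped_prem h).2.1.apps_congr (side_conditions h).2.1
      (HasType.instAt (B := []) (side_conditions h).1 (hasType_fixpt h))
  rw [← he] at ht ⊢
  exact Expr.relabel_self _ ht

end Park

-- The fixed-point formula as a trace around the cycle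

namespace PreProof

variable {R : Set Rule} {P : PreProof R}

namespace ElimNode

variable {n : P.Node} {d : Park} {h : P.parkAt n = some d}

/-- A step in which the trace formula belongs to the context of the rule. -/
lemma step_cycle_ctx {i i' : Park.Pos d.occs} {r : Rule} {j : ℕ} {A : Sequent}
    (hr : d.posRule i = some r) (hi : d.next i j = some (.inl i')) (hA : r.premAct[j]? = some A)
    (hc : r.conclAct.side d.side = []) (hp : A.side d.side = [])
    (hat : ((d.act i').side d.side)[0]? = some d.unfVars) :
    P.elim.Relevant (aux n d h i) (aux n d h i') ⟨d.side, 0⟩ ⟨d.side, 0⟩ ∧ ∀ k p,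
      P.elim.AnnStep (aux n d h i) (aux n d h i') ⟨d.side, 0⟩ ⟨d.side, 0⟩ k
        (((d.body.map fun _ => []).inst (d.annFix p)).appVars d.vars)
        (((d.body.map fun _ => []).inst (d.annFix p)).appVars d.vars) := by
  have hr' : P.elim.rule (aux n d h i) = some r := hr
  have h₁ := relevant_ctx hr' (child_aux_inl hi) hA d.side 0
  have hat' : (P.elim.sequent (aux n d h i')).at ⟨d.side, (A.side d.side).length + 0⟩ =
      some d.unfVars := by
    change ((d.act i').add d.ctx).at _ = _
    rw [hp]
    cases hs : d.side <;> rw [hs] at hat <;>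
      exact (List.getElem?_append_left (List.getElem?_eq_some_iff.1 hat).1).trans hat
  have h₂ (k p) := annStep_ctx hr' (child_aux_inl hi) hat' k
    (((d.body.map fun _ => []).inst (d.annFix p)).appVars d.vars)
  simp only [Park.relabel_unfVars (correct_of_parkAt h)] at h₂
  rw [hc, hp] at h₁ h₂
  exact ⟨h₁, h₂⟩

-- The fixed-point formula or its unfolding always stands next to the turnstile on the side of
-- Park's rule. Its label grows only at `loop`; at `mono` the `j`-th hole of the body holds a copy
-- of the fixed point with the current label.
open Park in
lemma step_cycle {i i' : Park.Pos d.occs} (hi : Park.Step i i') (hc : i.OnCycle)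
    (hc' : i'.OnCycle) :
    P.elim.Relevant (aux n d h i) (aux n d h i') ⟨d.side, 0⟩ ⟨d.side, 0⟩ ∧ ∀ k p,
      P.elim.AnnStep (aux n d h i) (aux n d h i') ⟨d.side, 0⟩ ⟨d.side, 0⟩ k (d.annAt p i)
        (d.annAt (if i = .loop then p ++ [k] else p) i') := by
  have hi' := hi.succ
  cases i <;> simp only [Pos.OnCycle] at hc <;> simp only [Pos.Succ] at hi'
  case unfolded =>
    rcases hi' with rfl | rfl
    · have hn : d.next .unfolded d.side.other.cutIdx = some (.inl .monoSwap) := by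
        simp [next, cutChild]
      refine step_cycle_ctx rfl hn (A := .on d.side.other [d.cutVars]) ?_ ?_ ?_ ?_ <;>
        obtain ⟨_ | _, _⟩ := d <;> rfl
    · exact hc'.elim
  case monoSwap =>
    subst hi'
    refine step_cycle_ctx rfl (j := 0) rfl (A := .on d.side.other ([] ++ [d.invVars, d.cutVars]))
      rfl ?_ ?_ ?_ <;> obtain ⟨_ | _, _⟩ := d <;> rfl
  case monoDrop =>
    subst hi'
    refine step_cycle_ctx rfl (j := 0) rfl (A := ⟨[], []⟩) rfl ?_ ?_ ?_ <;>
      obtain ⟨_ | _, _⟩ := d <;> rfl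
  case loop =>
    subst hi'
    have hp : (Rule.fix d.side ((Sequent.onBoth d.side [] [d.invVars]).add d.ctx) d.side.op d.ty
        d.body (d.vars.map .fvar)).Principal ⟨d.side, 0⟩ := by
      cases hs : d.side <;> simp [Rule.Principal, Rule.conclAct, Sequent.on, Sequent.side]
    have hn : d.next .loop 0 = some (.inl .unfolded) := rfl
    refine ⟨Or.inr ⟨_, 0, rfl, child_aux_inl (h := h) hn, rfl, _, rfl, Or.inr ⟨hp, ?_, trivial⟩⟩,
      fun k p => Or.inr ⟨_, 0, d.unfVars, rfl, child_aux_inl (h := h) hn, ?_, ?_⟩⟩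
    · cases hs : d.side <;> simp [Sequent.on, Sequent.side]
    · change ((d.act .unfolded).add d.ctx).at _ = _
      obtain ⟨_ | _, _⟩ := d <;> rfl
    · rw [Rule.annotate, if_pos hp]
      exact (Expr.unfoldHead_appVars k d.side.op p d.ty _ d.vars).symm
  case mono =>
    obtain ⟨j, rfl⟩ := hi'
    have hn : d.next .mono j = some (.inl (.leaf j)) := by simp [next]
    have hann (p) : (((d.body.appVars d.vars).holes 0
        (((d.body.map fun _ => []).inst (d.annFix p)).appVars d.vars)).getD j
          (((d.body.map fun _ => []).inst (d.annFix p)).appVars d.vars)) = d.annFix p := by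
      -- The variables y⃗ are free variables and contribute no occurrences, so each leaf matches an
      -- occurrence in the body itself.
      have hj : (j : ℕ) < d.body.countAt 0 := by
        have := j.2
        simpa [occs, Expr.appVars, Expr.countAt_apps, Expr.countAt, Function.comp_def] using this
      rw [Expr.holes_appVars, Expr.inst, Expr.holes_instAt, List.getD_replicate _ hj]
    obtain ⟨ψ, χ, hr, hA, hl⟩ : ∃ ψ χ, d.posRule .mono =
        some (.mono d.ctx d.ty (d.body.appVars d.vars) ψ χ d.vars) ∧
        (Rule.mono d.ctx d.ty (d.body.appVars d.vars) ψ χ d.vars).premAct[(j : ℕ)]? =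
          some (d.act (.leaf j)) ∧
        ((Rule.mono d.ctx d.ty (d.body.appVars d.vars) ψ χ d.vars).conclAct.side
          d.side).length = 1 := by
      have hj : (j : ℕ) < (d.body.appVars d.vars).countAt 0 := j.2
      cases hs : d.side
      · refine ⟨d.fixpt, d.inv, by simp [posRule, hs], ?_, rfl⟩
        simp [Rule.premAct, hj, act, hs, Sequent.onBoth, fixVars, invVars]
      · refine ⟨d.inv, d.fixpt, by simp [posRule, hs], ?_, rfl⟩
        simp [Rule.premAct, hj, act, hs, Sequent.onBoth, fixVars, invVars]
    have hp : (Rule.mono d.ctx d.ty (d.body.appVars d.vars) ψ χ d.vars).Principal ⟨d.side, 0⟩ :=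
      hl.ge
    refine ⟨Or.inr ⟨_, j, hr, child_aux_inl (h := h) hn, rfl, _, hA, Or.inr ⟨hp, ?_, trivial⟩⟩,
      fun k p => Or.inr ⟨_, j, d.fixVars, hr, child_aux_inl (h := h) hn, ?_, ?_⟩⟩
    · cases hs : d.side <;> simp [act, hs, Sequent.onBoth, Sequent.side]
    · change ((d.act (.leaf j)).add d.ctx).at _ = _
      obtain ⟨_ | _, _⟩ := d <;> rfl
    · rw [Rule.annotate, if_pos hp]
      exact congrArg (fun a => a.appVars d.vars) (hann p).symm
  case leaf j =>
    subst hi'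
    exact ⟨Or.inl ⟨rfl, rfl, rfl⟩, fun k p => Or.inl ⟨rfl, rfl⟩⟩

end ElimNode

open ElimNode

/-- A path that stays in the derivation of one of Park's rules and starts at the companion has a
trace of the required kind. -/
lemma isFixTrace_cycle {n : P.Node} {d : Park} {h : P.parkAt n = some d} {g : ℕ → Park.Pos d.occs}
    (hg : ∀ i, Park.Step (g i) (g (i + 1))) (h0 : g 0 = .loop) :
    P.elim.IsFixTrace d.side.op (fun i => aux n d h (g i)) fun _ => ⟨d.side, 0⟩ := by
  classical
  have hcyc := Park.onCycle_of_step hg h0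
  have hinf : {i | g i = .loop}.Infinite :=
    Set.infinite_of_not_bddAbove fun ⟨b, hb⟩ => by
      obtain ⟨l, hl, h⟩ := Park.exists_loop hg (b + 1)
      have := hb h
      omega
  -- The unfolding at time `i` uses the number `i`. The label at time `i` therefore lists the
  -- earlier visits to `loop`, and the infinite sequence enumerates all visits.
  refine ⟨⟨⟨fun i => ?_, fun i => (step_cycle (hg i) (hcyc i) (hcyc (i + 1))).1⟩, fun N => ?_⟩, id,
    fun i => d.annAt ((List.range (Nat.count (fun i => g i = .loop) i)).map
      (Nat.nth fun i => g i = .loop)) (g i),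
    ⟨⟨d.fixVars, ?_, ?_⟩, fun i => ?_, fun _ _ _ _ => id⟩, Nat.nth fun i => g i = .loop,
    fun m => ⟨Nat.nth (fun i => g i = .loop) m, ?_⟩⟩
  · change (((d.act (g i)).add d.ctx).at _).isSome
    obtain ⟨_ | _, _⟩ := d <;> cases g i <;> rfl
  · obtain ⟨l, hl, h⟩ := Park.exists_loop hg N
    refine ⟨l, hl, ?_⟩
    simp only [h]
    refine ⟨_, rfl, trivial, ?_⟩
    cases hs : d.side <;> simp [Rule.Principal, Rule.conclAct, Sequent.on, Sequent.side]
  · simp only [h0]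
    change ((d.act .loop).add d.ctx).at _ = _
    obtain ⟨_ | _, _⟩ := d <;> rfl
  · simp only [h0, Nat.count_zero, List.range_zero, List.map_nil]
    exact (Expr.map_appVars (fun _ => ([] : List ℕ)) d.fixpt d.vars).symm
  · have := (step_cycle (h := h) (hg i) (hcyc i) (hcyc (i + 1))).2 i
      ((List.range (Nat.count (fun i => g i = .loop) i)).map (Nat.nth fun i => g i = .loop))
    by_cases hi : g i = .loop
    · simp only [Nat.count_succ, hi, if_true, List.range_succ, List.map_append, List.map_cons,
        List.map_nil, id] at this ⊢
      rwa [Nat.nth_count hi]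
    · simpa [Nat.count_succ, hi] using this
  -- Counting visits from 0, visit `m` is preceded by exactly `m` visits, so the label there is the
  -- initial segment of length `m`.
  · have hm : g (Nat.nth (fun i => g i = .loop) m) = .loop := Nat.nth_mem_of_infinite hinf m
    simp only [hm, Nat.count_nth_of_infinite hinf]
    exact Expr.hasFix_apps (φ := d.annFix _) (Or.inl ⟨rfl, rfl⟩) _

/-- The global trace condition is preserved. -/
lemma GlobalTraceCondition.elim (hP : P.GlobalTraceCondition) : P.elim.GlobalTraceCondition := by
  classical
  intro (π : ℕ → P.ElimNode) hπ
  -- Either old nodes recur and the old trace condition applies, or the path is finally confined to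
  -- one inserted derivation.
  by_cases hinf : {i | (π i).IsMain}.Infinite
  · let M : ℕ → Prop := fun i => (π i).IsMain
    have hmem (i : ℕ) : M (Nat.nth M i) := Nat.nth_mem_of_infinite hinf i
    have hcount (i : ℕ) : Nat.count M (Nat.nth M i) = i := Nat.count_nth_of_infinite hinf i
    let ρ : ℕ → P.Node := fun i => (π (Nat.nth M i)).proj
    -- The count includes time `s`, so visit `i` is the latest visit to an old node up to `s`; since
    -- then the path has remained in the derivation at that node.
    have hρ (s i : ℕ) (hs : Nat.count M (s + 1) = i + 1) : (π s).proj = ρ i := by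
      induction s with
      | zero =>
        by_cases h : M 0
        · have := Nat.nth_count h
          have : i = 0 := by simpa [Nat.count_succ, h] using hs.symm
          simp_all [ρ]
        · simp [Nat.count_succ, h] at hs
      | succ s ih =>
        by_cases h : M (s + 1)
        · rw [Nat.count_succ, if_pos h, Nat.add_right_cancel_iff] at hs
          simp only [ρ, ← hs, Nat.nth_count h]
        · rw [Nat.count_succ, if_neg h] at hs
          rw [← ih hs]
          have hstep := hπ s
          cases hq : π (s + 1) with
          | main m => exact absurd trivial (hq ▸ h : ¬ (main m : P.ElimNode).IsMain)
          | aux n d hd l =>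
            rw [hq] at hstep
            rcases edge_aux hstep with ⟨h, -⟩ | ⟨i', h, -⟩ <;> rw [h] <;> rfl
    have hpath : P.IsPath ρ := by
      intro i
      obtain ⟨s, hs⟩ : ∃ s, Nat.nth M (i + 1) = s + 1 := by
        refine Nat.exists_eq_succ_of_ne_zero fun h => ?_
        have := hcount (i + 1)
        simp [h] at this
      have h₁ := hcount (i + 1)
      rw [hs] at h₁
      have h₂ := hmem (i + 1)
      have hstep := hπ s
      simp only [ρ, hs]
      rw [hs] at h₂
      cases hq : π (s + 1) with
      | main m =>
        have := hρ s i h₁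
        simp only [ρ] at this
        rw [← this]
        exact edge_main (hq ▸ hstep)
      | aux n d hd l => exact (hq ▸ h₂ : (aux n d hd l : P.ElimNode).IsMain).elim
    obtain ⟨N, τ, hτ⟩ := hP ρ hpath
    -- This keeps the truncated subtraction of `N + 1` in the definition of `c` below exact.
    have hN (s : ℕ) : N + 1 ≤ Nat.count M (Nat.nth M N + s + 1) := by
      refine le_trans ?_ (Nat.count_monotone M (by omega : Nat.nth M N + 1 ≤ _))
      rw [Nat.count_succ, if_pos (hmem N), hcount]
    have key {σ : FixOp} (h : P.IsFixTrace σ (fun i => ρ (N + i)) τ) :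
        ∃ τ', τ' 0 = τ 0 ∧ P.elim.IsFixTrace σ (fun i => π (Nat.nth M N + i)) τ' := by
      refine h.elim (c := fun s => Nat.count M (Nat.nth M N + s + 1) - (N + 1))
        (fun i => hπ _) (fun s => hρ _ _ ?_) (hmem N) ?_ (fun s hs => ?_) (fun s hs => ?_)
        fun i => ⟨Nat.nth M (N + i) - Nat.nth M N, ?_⟩
      · have := hN s
        omega
      · simp [Nat.count_succ, hmem N, hcount]
      · have := hN s
        have hs' : M (Nat.nth M N + s + 1) := hs
        simp only [← add_assoc]
        rw [Nat.count_succ _ (Nat.nth M N + s + 1), if_pos hs']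
        omega
      · have hs' : ¬ M (Nat.nth M N + s + 1) := hs
        simp only [← add_assoc]
        rw [Nat.count_succ _ (Nat.nth M N + s + 1), if_neg hs', add_zero]
      · have hle : Nat.nth M N ≤ Nat.nth M (N + i) :=
          (Nat.nth_monotone hinf) (Nat.le_add_right N i)
        simp only [Nat.add_sub_cancel' hle]
        refine ⟨?_, hmem _⟩
        rw [Nat.count_succ, if_pos (hmem _), hcount]
        omega
    rcases hτ with ⟨hs, hτ⟩ | ⟨hs, hτ⟩ <;> obtain ⟨τ', h0, hτ'⟩ := key hτ
    · exact ⟨_, τ', Or.inl ⟨h0 ▸ hs, hτ'⟩⟩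
    · exact ⟨_, τ', Or.inr ⟨h0 ▸ hs, hτ'⟩⟩
  · obtain ⟨N, hN⟩ := (Set.not_infinite.1 hinf).bddAbove
    obtain ⟨n, d, h, i, hi⟩ : ∃ n d h i, π (N + 1) = aux n d h i := by
      cases hq : π (N + 1) with
      | main m =>
        have : N + 1 ≤ N := hN (show (π _).IsMain from hq ▸ trivial)
        omega
      | aux n d h i => exact ⟨n, d, h, i, rfl⟩
    -- Passing to another derivation would require visiting an old node first, and there are none
    -- after time `N`.
    have step (l : ℕ) (i : Park.Pos d.occs) (hl : N < l) (hi : π l = aux n d h i) :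
        ∃ i', π (l + 1) = aux n d h i' := by
      have hstep := hπ l
      cases hq : π (l + 1) with
      | main m =>
        have : l + 1 ≤ N := hN (show (π _).IsMain from hq ▸ trivial)
        omega
      | aux n' d' h' i' =>
        rw [hq, hi] at hstep
        rcases edge_aux hstep with ⟨h, -⟩ | ⟨_, h, -⟩
        · cases h
        · cases h
          exact ⟨i', rfl⟩
    have all (l : ℕ) : ∃ i, π (N + 1 + l) = aux n d h i := by
      induction l with
      | zero => exact ⟨i, hi⟩
      | succ l ih =>
        obtain ⟨i, hi⟩ := ih
        exact step (N + 1 + l) i (by omega) hi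
    choose g hg using all
    have hstep (l : ℕ) : Park.Step (g l) (g (l + 1)) := by
      have := hπ (N + 1 + l)
      rw [add_assoc (N + 1), hg, hg] at this
      rcases edge_aux this with ⟨h, -⟩ | ⟨_, h, hs⟩
      · cases h
      · cases h
        exact hs
    -- The tail is taken from a visit to `loop`, where the trace starts with empty labels.
    obtain ⟨m, -, hm⟩ := Park.exists_loop hstep 0
    have := isFixTrace_cycle (h := h) (g := fun l => g (m + l)) (fun l => hstep (m + l)) hm
    refine ⟨N + 1 + m, fun _ => ⟨d.side, 0⟩, ?_⟩
    simp only [add_assoc _ m, hg]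
    cases hs : d.side <;> rw [hs] at this
    · exact Or.inl ⟨rfl, this⟩
    · exact Or.inr ⟨rfl, this⟩

end PreProof

end HFL

theorem mainTheorem5 (S : HFL.Sequent)
    (h : HFL.CyclicallyProvable (HFL.baseRules ∪ HFL.parkRules) S) :
    HFL.CyclicallyProvable HFL.baseRules S := by
  obtain ⟨P, hS, hP⟩ := h
  exact ⟨P.elim, hS, hP.elim⟩
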